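/- Let $q,t,r$ be independent indeterminates. For $n\ge 0$ put $[n]_q := 1+q+\cdots+q^{n-1}$ (so $[0]_q=0$), $[n]_q! := \prod_{j=1}^n [j]_q$ (so $[0]_q!=1$), and $\exp_q(z) := \sum_{n\ge 0} \frac{z^n}{[n]_q!}$. For a permutation $\sigma$ of $\{1,\dots,n\}$ let $$\mathrm{maj}(\sigma) := \sum_{\substack{1\le i\le n-1\\ \sigma(i)>\sigma(i+1)}} i,\qquad \mathrm{exc}(\sigma) := |\{i : \sigma(i)>i\}|,\qquad \mathrm{fix}(\sigma) := |\{i : \sigma(i)=i\}|,$$ and let $$A_n^{\mathrm{maj},\mathrm{exc},\mathrm{fix}}(q,t,r) := \sum_{\sigma\in\mathfrak S_n} q^{\mathrm{maj}(\sigma)}\, t^{\mathrm{exc}(\sigma)}\, r^{\mathrm{fix}(\sigma)},\qquad A_0^{\mathrm{maj},\mathrm{exc},\mathrm{fix}}(q,t,r) := 1.$$ Then, as formal power series in $z$ with coefficients in $\mathbb{Q}(q,t,r)$, $$\sum_{n\ge 0} A_n^{\mathrm{maj},\mathrm{exc},\mathrm{fix}}(q,t,r)\,\frac{z^n}{[n]_q!}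 \;=\; \frac{(1-tq)\,\exp_q(rz)}{\exp_q(ztq)-tq\,\exp_q(z)}.$$ -/

import Mathlib

namespace QEuler

/-- The `q`-integer `[n]_q = 1 + q + ⋯ + q^(n-1)`; in particular `[0]_q = 0`. -/
def qInt {R : Type*} [CommSemiring R] (q : R) (n : ℕ) : R :=
  ∑ i ∈ Finset.range n, q ^ i

/-- The `q`-factorial `[n]_q! = [1]_q [2]_q ⋯ [n]_q`; in particular `[0]_q! = 1`. -/
def qFact {R : Type*} [CommSemiring R] (q : R) (n : ℕ) : R :=
  ∏ j ∈ Finset.Icc 1 n, qInt q j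

/-- The descent set of `σ`. A permutation of `{1, …, n}` is encoded as a permutation of
`Fin n = {0, …, n-1}`, so `i : Fin n` stands for the position `i + 1`; it is a descent if there
is a next position `j = i + 1` in `Fin n` and `σ i > σ j`. -/
def descentSet {n : ℕ} (σ : Equiv.Perm (Fin n)) : Finset (Fin n) :=
  {i | ∃ j : Fin n, (j : ℕ) = (i : ℕ) + 1 ∧ σ j < σ i}

/-- The major index: the sum of the descents, counted as positions in `{1, …, n-1}`. -/
def maj {n : ℕ} (σ : Equiv.Perm (Fin n)) : ℕ :=
  ∑ i ∈ descentSet σ, ((i : ℕ) + 1)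

/-- The excedance number: the number of positions `i` with `σ i > i`. (The last position is
never an excedance.) -/
def exc {n : ℕ} (σ : Equiv.Perm (Fin n)) : ℕ :=
  (Finset.univ.filter fun i : Fin n => i < σ i).card

/-- The number of fixed points. -/
def fix {n : ℕ} (σ : Equiv.Perm (Fin n)) : ℕ :=
  (Finset.univ.filter fun i : Fin n => σ i = i).card

/-- `A_n^{maj,exc,fix}(q,t,r)`, the sum over all permutations `σ` of `n` letters of
`q^maj(σ) t^exc(σ) r^fix(σ)`. For `n = 0` the only permutation is the empty one and the value
is `1`. -/
def eulerPoly {R : Type*} [CommSemiring R] (n : ℕ) (q t r : R) : R :=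
  ∑ σ : Equiv.Perm (Fin n), q ^ maj σ * t ^ exc σ * r ^ fix σ

/-- The power series `exp_q(z) = ∑_n z^n / [n]_q!` in `z`. -/
noncomputable def qExp {K : Type*} [Field K] (q : K) : PowerSeries K :=
  PowerSeries.mk fun n => (qFact q n)⁻¹

/-- The field `ℚ(q,t,r)` of rational functions in three indeterminates. -/
abbrev RatFun3 : Type := FractionRing (MvPolynomial (Fin 3) ℚ)

/-- The indeterminate `q`. -/
noncomputable def qVar : RatFun3 := algebraMap (MvPolynomial (Fin 3) ℚ) RatFun3 (MvPolynomial.X 0)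

/-- The indeterminate `t`. -/
noncomputable def tVar : RatFun3 := algebraMap (MvPolynomial (Fin 3) ℚ) RatFun3 (MvPolynomial.X 1)

/-- The indeterminate `r`. -/
noncomputable def rVar : RatFun3 := algebraMap (MvPolynomial (Fin 3) ℚ) RatFun3 (MvPolynomial.X 2)

/-- No division by zero occurs in `z^n / [n]_q!`. -/
theorem qFact_qVar_ne_zero (n : ℕ) : qFact qVar n ≠ 0 := by
  have key : qFact qVar n = algebraMap (MvPolynomial (Fin 3) ℚ) RatFun3
      (qFact (MvPolynomial.X 0) n) := by
    simp [qFact, qInt, qVar]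
  rw [key]
  intro h
  have h0 : qFact (MvPolynomial.X 0 : MvPolynomial (Fin 3) ℚ) n = 0 :=
    (IsFractionRing.injective (MvPolynomial (Fin 3) ℚ) RatFun3) (by simpa using h)
  have h1 := congrArg (MvPolynomial.eval (fun _ => (1 : ℚ))) h0
  simp only [qFact, qInt, map_prod, map_sum, map_pow, MvPolynomial.eval_X, one_pow, map_zero,
    Finset.sum_const, Finset.card_range, nsmul_eq_mul, mul_one] at h1
  rw [Finset.prod_eq_zero_iff] at h1
  obtain ⟨j, hj, hj0⟩ := h1
  have : j = 0 := by exact_mod_cast hj0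
  simp [this] at hj

/-- The series `exp_q(ztq) - tq exp_q(z)` has nonzero constant term `1 - tq`, so it is invertible
in `ℚ(q,t,r)⟦z⟧`. -/
theorem constantCoeff_denominator_ne_zero :
    PowerSeries.constantCoeff (PowerSeries.rescale (tVar * qVar) (qExp qVar)
      - PowerSeries.C (tVar * qVar) * qExp qVar) ≠ 0 := by
  have key : PowerSeries.constantCoeff (PowerSeries.rescale (tVar * qVar) (qExp qVar)
      - PowerSeries.C (tVar * qVar) * qExp qVar)
      = algebraMap (MvPolynomial (Fin 3) ℚ) RatFun3
        (1 - MvPolynomial.X 1 * MvPolynomial.X 0) := by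
    rw [← PowerSeries.coeff_zero_eq_constantCoeff_apply, map_sub, PowerSeries.coeff_rescale,
      PowerSeries.coeff_C_mul, qExp, PowerSeries.coeff_mk]
    simp [qFact, qVar, tVar]
  rw [key]
  intro h
  have h0 : (1 - MvPolynomial.X 1 * MvPolynomial.X 0 : MvPolynomial (Fin 3) ℚ) = 0 :=
    (IsFractionRing.injective (MvPolynomial (Fin 3) ℚ) RatFun3) (by simpa using h)
  have h1 := congrArg (MvPolynomial.eval (fun _ => (0 : ℚ))) h0
  simp at h1

end QEuler

/-! Write `(q)_n` for `∏_{i=1}^n (1 - q^i)`. Up to powers of `1 - q`, absorbed in `z`, the left side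
is the sum of `A_n z^n / (q)_n`. The proof expands this as a generating function of words and
evaluates that by a variant of MacMahon's master theorem.

Compare positions by (type, value), with excedances before anti-excedances before fixed points. Then
`maj` is `exc` plus the sum of the lexicographic descents (`maj_eq_sum_dexSet_add_exc`), which
produces the product `tq`. Dividing by `(q)_n` sums over sequences `f` that decrease weakly, and
strictly at those descents (`sum_dropsBy`). A pair `(σ, f)` is the same as a weakly increasing word
`φ`, whose letters record `f` and the type, such that `σ` increases on the blocks of `φ`.

For fixed `φ`, such a `σ` is determined by the rearrangement `φ ∘ σ⁻¹`. Having the prescribed types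
is then a condition on each letter of the rearrangement separately, provided one position of every
block is treated specially (`forall_allowed_iff`). The count is therefore a coefficient of a product
of linear forms (`coeff_rowProd_content`). Summing over all contents, the letters are eliminated one
by one (`masterSum_succ`); the matrices stay in a family with one parameter `u`, and a closed
product formula results (`wordSum_triple`). Euler's product for `∑ v^n / (q)_n` turns its factors
into exponentials (`truncated_identity`).

All sums are kept finite by taking `q` and `z` nilpotent. Coefficients of `z^n` are extracted modulo
`X^(n+1)`, and an identity of polynomials valid modulo every power of `q` holds outright
(`polynomial_recurrence`). -/

namespace QEuler

/-! ### Lexicographic descents and the major index -/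

/-- The type of a position of `σ`: `0` for an excedance, `1` for an anti-excedance, `2` for a
fixed point. -/
def kind {n : ℕ} (σ : Equiv.Perm (Fin n)) (i : Fin n) : Fin 3 :=
  if i < σ i then 0 else if σ i < i then 1 else 2

/-- The positions `i` at which the pair (type, value) decreases lexicographically. -/
def dexSet {n : ℕ} (σ : Equiv.Perm (Fin n)) : Finset (Fin n) :=
  {i | ∃ j : Fin n, (j : ℕ) = (i : ℕ) + 1 ∧
    ¬ (kind σ i < kind σ j ∨ (kind σ i = kind σ j ∧ σ i < σ j))}

theorem sum_range_succ_mul_sub (e : ℕ → ℤ) (n : ℕ) :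
    ∑ i ∈ Finset.range n, ((i : ℤ) + 1) * (e i - e (i + 1))
      = ∑ i ∈ Finset.range n, e i - n * e n := by
  induction n with
  | zero => simp
  | succ n ih => rw [Finset.sum_range_succ, Finset.sum_range_succ, ih]; push_cast; ring

/-- With `e` the indicator of excedances, the indicators of ordinary and lexicographic descents at
`i` differ by `e i - e (i + 1)`: an excedance followed by a non-excedance is always a descent, the
reverse order never is, and in the remaining cases the two notions agree. Abel summation turns the
weighted differences into `exc σ`. -/
theorem maj_eq_sum_dexSet_add_exc {n : ℕ} (σ : Equiv.Perm (Fin n)) :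
    maj σ = ∑ i ∈ dexSet σ, ((i : ℕ) + 1) + exc σ := by
  classical
  let e : ℕ → ℤ := fun k => if h : k < n then (if (⟨k, h⟩ : Fin n) < σ ⟨k, h⟩ then 1 else 0) else 0
  have hpt : ∀ i : Fin n, (if i ∈ descentSet σ then ((i : ℤ) + 1) else 0)
      = (if i ∈ dexSet σ then ((i : ℤ) + 1) else 0) + ((i : ℤ) + 1) * (e i - e (i + 1)) := by
    intro i
    have hei : e i = if i < σ i then 1 else 0 := by simp [e]
    by_cases hi : (i : ℕ) + 1 < n
    · set j : Fin n := ⟨i + 1, hi⟩ with hj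
      have hej : e (i + 1) = if j < σ j then 1 else 0 := by simp [e, hi, hj]
      have h1 : i ∈ descentSet σ ↔ σ j < σ i := by
        simp only [descentSet, Finset.mem_filter, Finset.mem_univ, true_and]
        constructor
        · rintro ⟨k, hk, h⟩
          have : k = j := Fin.ext (by simp [hj, hk])
          rwa [this] at h
        · intro h; exact ⟨j, rfl, h⟩
      have h2 : i ∈ dexSet σ ↔ ¬ (kind σ i < kind σ j ∨ (kind σ i = kind σ j ∧ σ i < σ j)) := by
        simp only [dexSet, Finset.mem_filter, Finset.mem_univ, true_and]
        constructor
        · rintro ⟨k, hk, h⟩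
          have : k = j := Fin.ext (by simp [hj, hk])
          rwa [this] at h
        · intro h; exact ⟨j, rfl, h⟩
      have hne : σ i ≠ σ j := fun h => by
        have := σ.injective h
        have := congrArg Fin.val this
        simp [hj] at this
      have hne' : (σ i : ℕ) ≠ σ j := fun h => hne (Fin.ext h)
      rw [hei, hej]
      simp only [h1, h2]
      have hjv : (j : ℕ) = i + 1 := rfl
      simp only [kind, Fin.lt_def, hjv]
      have : ∀ a b : ℕ, a < b ∨ a = b ∨ b < a := fun a b => lt_trichotomy a b
      rcases this i (σ i) with h | h | h <;> rcases this (i + 1) (σ j) with h' | h' | h' <;>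
        rcases this (σ i) (σ j) with h'' | h'' | h'' <;>
        first
        | omega
        | (simp [h, h', h'', h.not_gt, h'.not_gt, h''.not_gt]; done)
        | (rw [← h] at h'' ⊢; simp [h', h'', h'.not_gt, h''.not_gt])
    · have h1 : i ∉ descentSet σ := by
        simp only [descentSet, Finset.mem_filter, Finset.mem_univ, true_and, not_exists]
        rintro k ⟨hk, -⟩
        have := k.isLt
        omega
      have h2 : i ∉ dexSet σ := by
        simp only [dexSet, Finset.mem_filter, Finset.mem_univ, true_and, not_exists]
        rintro k ⟨hk, -⟩
        have := k.isLt
        omega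
      have h3 : ¬ i < σ i := by
        rw [Fin.lt_def]; have := (σ i).isLt; omega
      have h4 : e (i + 1) = 0 := by simp [e, hi]
      simp [h1, h2, hei, h3, h4]
  have hsum := Finset.sum_congr rfl (fun i (_ : i ∈ (Finset.univ : Finset (Fin n))) => hpt i)
  rw [Finset.sum_add_distrib, Fin.sum_univ_eq_sum_range
    (fun i => ((i : ℤ) + 1) * (e i - e (i + 1))) n, sum_range_succ_mul_sub] at hsum
  have hen : e n = 0 := by simp [e]
  have hexc : ∑ i ∈ Finset.range n, e i = exc σ := by
    rw [← Fin.sum_univ_eq_sum_range, exc, Finset.card_filter]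
    push_cast
    exact Finset.sum_congr rfl fun i _ => by simp [e]
  rw [hen, hexc, mul_zero, sub_zero] at hsum
  rw [← Finset.sum_filter, ← Finset.sum_filter, Finset.filter_mem_eq_inter,
    Finset.filter_mem_eq_inter, Finset.univ_inter, Finset.univ_inter] at hsum
  rw [maj]
  exact_mod_cast hsum

/-! ### Sequences with prescribed drops -/

/-- The functions `f` on `Fin n` with `f (i + 1) + δ i ≤ f i`. -/
def DropsBy {n : ℕ} (δ f : Fin n → ℕ) : Prop :=
  ∀ i j : Fin n, (j : ℕ) = (i : ℕ) + 1 → f j + δ i ≤ f i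

theorem dropsBy_cons {n : ℕ} (δ : Fin (n + 1) → ℕ) (a : ℕ) (f : Fin n → ℕ) :
    DropsBy δ (Fin.cons a f : Fin (n + 1) → ℕ) ↔
      (∀ h : 0 < n, f ⟨0, h⟩ + δ 0 ≤ a) ∧ DropsBy (fun i => δ i.succ) f := by
  constructor
  · intro h
    refine ⟨fun hn => ?_, fun i j hij => ?_⟩
    · have h0 := h 0 (Fin.succ ⟨0, hn⟩) rfl
      rwa [Fin.cons_succ, Fin.cons_zero] at h0
    · simpa using h i.succ j.succ (by simp [hij])
  · rintro ⟨h1, h2⟩ i j hij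
    induction i using Fin.cases with
    | zero =>
      induction j using Fin.cases with
      | zero => simp at hij
      | succ j =>
        have hj : (j : ℕ) = 0 := by simpa using hij
        have hn : 0 < n := by have := j.isLt; omega
        obtain rfl : j = ⟨0, hn⟩ := Fin.ext hj
        rw [Fin.cons_succ, Fin.cons_zero]
        exact h1 hn
    | succ i =>
      induction j using Fin.cases with
      | zero => simp at hij
      | succ j => simpa using h2 i j (by simpa using hij)

-- Induction sums out the first, largest entry by a geometric series. Its lower bound is the second
-- entry plus `δ 0`, so the second entry inherits the extra weight; `s` counts the entries already
-- removed. Bounding entries by `M` loses nothing because `q ^ M = 0`.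
open Classical in
theorem sum_dropsBy {R : Type*} [CommRing R] (q : R) (M : ℕ) (hq : q ^ M = 0) (n : ℕ) (s : ℕ)
    (δ : Fin n → ℕ) (hδ : ∀ i : Fin n, (i : ℕ) + 1 = n → δ i = 0) :
    (∏ i : Fin n, (1 - q ^ (s + i + 1))) *
      ∑ f : Fin n → Fin M, (if DropsBy δ (fun i => (f i : ℕ)) then
        q ^ (∑ i, (f i : ℕ) + ∑ i : Fin n, if (i : ℕ) = 0 then s * (f i : ℕ) else 0) else 0)
      = q ^ (∑ i : Fin n, (s + i + 1) * δ i) := by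
  induction n generalizing s with
  | zero => simp [DropsBy]
  | succ n ih =>
    have geo : ∀ a : ℕ, (1 - q ^ (s + 1)) *
        ∑ c : Fin M, (if a ≤ (c : ℕ) then q ^ ((s + 1) * (c : ℕ)) else 0) = q ^ ((s + 1) * a) := by
      intro a
      rw [Fin.sum_univ_eq_sum_range (fun c => if a ≤ c then q ^ ((s + 1) * c) else 0) M,
        ← Finset.sum_filter]
      have e : (Finset.range M).filter (fun c => a ≤ c) = Finset.Ico a M := by
        ext c; simp [and_comm]
      rw [e]
      have hM : q ^ ((s + 1) * M) = 0 := by rw [mul_comm, pow_mul, hq, zero_pow (by omega)]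
      rcases le_or_gt a M with h | h
      · simp only [pow_mul]
        have := geom_sum_Ico_mul_neg (q ^ (s + 1)) h
        rw [mul_comm, this, ← pow_mul, ← pow_mul, hM, sub_zero]
      · rw [Finset.Ico_eq_empty (by omega), Finset.sum_empty, mul_zero]
        obtain ⟨d, rfl⟩ := Nat.exists_eq_add_of_lt h
        rw [show (s + 1) * (M + d + 1) = (s + 1) * M + (s + 1) * (d + 1) by ring, pow_add, hM,
          zero_mul]
    -- The least admissible first entry; it is `0` when no second entry exists, which fits because
    -- then `δ 0 = 0`.
    let a : (Fin n → Fin M) → ℕ := fun f => if h : 0 < n then (f ⟨0, h⟩ : ℕ) + δ 0 else 0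
    have hsplit : ∑ f : Fin (n + 1) → Fin M, (if DropsBy δ (fun i => (f i : ℕ)) then
        q ^ (∑ i, (f i : ℕ) + ∑ i : Fin (n + 1), if (i : ℕ) = 0 then s * (f i : ℕ) else 0) else 0)
        = ∑ f : Fin n → Fin M, (if DropsBy (fun i => δ i.succ) (fun i => (f i : ℕ)) then
          q ^ (∑ i, (f i : ℕ)) *
          ∑ c : Fin M, (if a f ≤ (c : ℕ) then q ^ ((s + 1) * (c : ℕ)) else 0) else 0) := by
      rw [← (Fin.consEquiv (fun _ : Fin (n + 1) => Fin M)).sum_comp, Fintype.sum_prod_type,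
        Finset.sum_comm]
      refine Finset.sum_congr rfl fun f _ => ?_
      by_cases hf : DropsBy (fun i => δ i.succ) (fun i => (f i : ℕ))
      · rw [if_pos hf, Finset.mul_sum]
        refine Finset.sum_congr rfl fun c _ => ?_
        have e : (fun i => (((Fin.consEquiv (fun _ : Fin (n + 1) => Fin M)) (c, f) i : Fin M) : ℕ))
            = (Fin.cons (c : ℕ) (fun i => (f i : ℕ)) : Fin (n + 1) → ℕ) := by
          funext i
          induction i using Fin.cases <;> simp [Fin.consEquiv]
        have e' := fun i => congrFun e i
        simp only [e']
        have hiff : DropsBy δ (Fin.cons (c : ℕ) (fun i => (f i : ℕ)) : Fin (n + 1) → ℕ)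
            ↔ a f ≤ c := by
          rw [dropsBy_cons]
          simp only [hf, and_true, a]
          split_ifs with hn <;> simp [hn]
        simp only [hiff, Fin.sum_univ_succ, Fin.cons_zero, Fin.cons_succ]
        simp only [Fin.val_succ, Nat.succ_ne_zero, if_false, Finset.sum_const_zero]
        split_ifs
        · rw [← pow_add]; congr 1; simp; ring
        · simp_all
        · simp
      · rw [if_neg hf]
        refine Finset.sum_eq_zero fun c _ => if_neg fun h => hf ?_
        intro i j hij
        simpa [Fin.consEquiv] using h i.succ j.succ (by simp [hij])
    have hδ' : ∀ i : Fin n, (i : ℕ) + 1 = n → δ i.succ = 0 := fun i hi => hδ _ (by simp [hi])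
    have ih' := ih (s + 1) (fun i => δ i.succ) hδ'
    rw [hsplit, Fin.prod_univ_succ, mul_comm (1 - _) (∏ i, _), mul_assoc, Finset.mul_sum]
    have hterm : ∀ f : Fin n → Fin M, (1 - q ^ (s + ((0 : Fin (n + 1)) : ℕ) + 1)) *
        (if DropsBy (fun i => δ i.succ) (fun i => (f i : ℕ)) then
          q ^ (∑ i, (f i : ℕ)) *
          ∑ c : Fin M, (if a f ≤ (c : ℕ) then q ^ ((s + 1) * (c : ℕ)) else 0) else 0)
        = q ^ ((s + 1) * δ 0) * (if DropsBy (fun i => δ i.succ) (fun i => (f i : ℕ)) then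
          q ^ (∑ i, (f i : ℕ) + ∑ i : Fin n, if (i : ℕ) = 0 then (s + 1) * (f i : ℕ) else 0)
          else 0) := by
      intro f
      split_ifs
      · have g := geo (a f)
        rw [Fin.val_zero, add_zero, mul_left_comm, g, ← pow_add, ← pow_add]
        congr 1
        cases n with
        | zero =>
          have : δ 0 = 0 := hδ 0 rfl
          simp [a, this]
        | succ n =>
          simp [a, Fin.sum_univ_succ]
          ring
      · simp
    simp only [hterm]
    rw [← Finset.mul_sum, mul_left_comm]
    have ep : ∏ i : Fin n, (1 - q ^ (s + (i.succ : ℕ) + 1)) = ∏ i : Fin n, (1 - q ^ (s + 1 + i + 1)) :=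
      Finset.prod_congr rfl fun i _ => by rw [Fin.val_succ]; congr 2; omega
    rw [ep, ih', ← pow_add, Fin.sum_univ_succ]
    congr 1
    simp only [Fin.val_zero, add_zero, Fin.val_succ]
    congr 1
    exact Finset.sum_congr rfl fun i _ => by ring

/-! ### A master theorem with one special factor per row, by elimination -/

open MvPolynomial in
/-- The linear form attached to row `f` of the matrix `A`. -/
noncomputable def rowForm {S : Type*} [CommRing S] {N : ℕ} (A : Matrix (Fin N) (Fin N) S)
    (f : Fin N) : MvPolynomial (Fin N) S :=
  ∑ g, C (A f g) * X g

/-- A product of `m` linear forms of row `f`: one from `A`, the others from `B`. -/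
noncomputable def rowProd {S : Type*} [CommRing S] {N : ℕ} (A B : Matrix (Fin N) (Fin N) S)
    (f : Fin N) : ℕ → MvPolynomial (Fin N) S
  | 0 => 1
  | m + 1 => rowForm A f * rowForm B f ^ m

/-- The generating function of the diagonal coefficients in MacMahon's master theorem,
truncated at exponents below `K`. -/
noncomputable def masterSum {S : Type*} [CommRing S] (K : ℕ) {N : ℕ}
    (A B : Matrix (Fin N) (Fin N) S) (y : Fin N → S) : S :=
  ∑ m : Fin N → Fin K, (∏ f, y f ^ (m f : ℕ)) *
    MvPolynomial.coeff (Finsupp.equivFunOnFinite.symm fun f => (m f : ℕ))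
      (∏ f, rowProd A B f (m f))

section Functional
open Polynomial

/-- The one-variable analogue of `rowProd`. -/
noncomputable def linProd {A : Type*} [CommRing A] (L a b : A) : ℕ → A[X]
  | 0 => 1
  | m + 1 => (C L + C a * X) * (C L + C b * X) ^ m

theorem coeff_linProd_self {A : Type*} [CommRing A] (L a b : A) (m : ℕ) :
    (linProd L a b (m + 1)).coeff (m + 1) = a * b ^ m := by
  have h : ∀ c : A, (C L + C c * X : A[X]).natDegree ≤ 1 := fun c => by compute_degree
  have h2 : ((C L + C b * X : A[X]) ^ m).natDegree ≤ m := by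
    simpa using Polynomial.natDegree_pow_le_of_le m (h b)
  have h3 : ((C L + C b * X : A[X]) ^ m).coeff m = b ^ m := by
    have := Polynomial.coeff_pow_of_natDegree_le (m := m) (h b)
    simpa using this
  rw [linProd, add_comm m 1, Polynomial.coeff_mul_add_eq_of_natDegree_le (h a) h2, h3]
  simp

/-- Passing from `m` to `m + 1` multiplies `linProd` by `L + b X`, and multiplication by `X` shifts
coefficients; the top term dies by `y ^ K = 0`. At `m = 0` the new factor is `L + a X` instead, but
the constant coefficient does not see `a`. -/
theorem sum_coeff_X_mul_linProd {A : Type*} [CommRing A] (y L a b : A) (K : ℕ) (hy : y ^ K = 0)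
    (P : A[X]) :
    (1 - b * y) * ∑ m ∈ Finset.range K, y ^ m * (X * P * linProd L a b m).coeff m
      = y * L * ∑ m ∈ Finset.range K, y ^ m * (P * linProd L a b m).coeff m := by
  have key : ∀ m, (P * linProd L a b (m + 1)).coeff m
      = L * (P * linProd L a b m).coeff m + b * (X * P * linProd L a b m).coeff m := by
    intro m
    cases m with
    | zero => simp [linProd, Polynomial.mul_coeff_zero]; ring
    | succ m =>
      have : P * linProd L a b (m + 1 + 1)
          = C L * (P * linProd L a b (m + 1)) + C b * (X * P * linProd L a b (m + 1)) := by
        simp only [linProd, pow_succ]; ring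
      rw [this, coeff_add, coeff_C_mul, coeff_C_mul]
  have h1 : ∑ m ∈ Finset.range K, y ^ m * (X * P * linProd L a b m).coeff m
      = y * ∑ m ∈ Finset.range K, y ^ m * (P * linProd L a b (m + 1)).coeff m := by
    have e1 := Finset.sum_range_succ (fun m => y ^ m * (X * P * linProd L a b m).coeff m) K
    have e2 := Finset.sum_range_succ' (fun m => y ^ m * (X * P * linProd L a b m).coeff m) K
    rw [hy, zero_mul, add_zero] at e1
    rw [← e1, e2, Finset.mul_sum]
    simp only [mul_assoc X P, Polynomial.coeff_X_mul, Polynomial.coeff_X_mul_zero, mul_zero,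
      add_zero]
    exact Finset.sum_congr rfl fun m _ => by ring
  simp only [key, mul_add, Finset.sum_add_distrib] at h1
  rw [sub_mul, one_mul]
  nth_rewrite 1 [h1]
  simp only [Finset.mul_sum]
  rw [← Finset.sum_add_distrib, ← Finset.sum_sub_distrib]
  exact Finset.sum_congr rfl fun m _ => by ring

/-- The left side is a linear functional of `P` for which multiplication by `X` acts as the scalar
`y L c`, the solution of `x = y (L + b x)`. Hence it is evaluation there times its value at `1`, and
that value is `1 + a y / (1 - b y)`. -/
theorem sum_coeff_linProd {A : Type*} [CommRing A] (y L a b c : A) (K : ℕ) (hy : y ^ K = 0)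
    (hc : c * (1 - b * y) = 1) (P : A[X]) :
    ∑ m ∈ Finset.range K, y ^ m * (P * linProd L a b m).coeff m
      = c * (1 - (b - a) * y) * P.eval (y * L * c) := by
  induction P using Polynomial.induction_on with
  | C p =>
    simp only [Polynomial.coeff_C_mul, Polynomial.eval_C]
    have h1 : (1 - b * y) * ∑ m ∈ Finset.range K, y ^ m * (linProd L a b m).coeff m
        = 1 - (b - a) * y := by
      cases K with
      | zero =>
        have : Subsingleton A := subsingleton_of_zero_eq_one (by simpa using hy.symm)
        exact Subsingleton.elim _ _
      | succ K =>
        rw [Finset.sum_range_succ']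
        simp only [coeff_linProd_self]
        have h2 : ∑ k ∈ Finset.range K, y ^ (k + 1) * (a * b ^ k)
            = a * y * ∑ k ∈ Finset.range K, (b * y) ^ k := by
          rw [Finset.mul_sum]; exact Finset.sum_congr rfl fun m _ => by ring
        have h3 := mul_neg_geom_sum (b * y) K
        have h4 : a * y * (b * y) ^ K = 0 := by
          have : a * y * (b * y) ^ K = a * b ^ K * y ^ (K + 1) := by ring
          rw [this, hy, mul_zero]
        simp only [linProd, Polynomial.coeff_one_zero, pow_zero, mul_one]
        rw [h2]
        linear_combination a * y * h3 - h4
    have h5 : ∑ m ∈ Finset.range K, y ^ m * (p * (linProd L a b m).coeff m)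
        = p * ∑ m ∈ Finset.range K, y ^ m * (linProd L a b m).coeff m := by
      rw [Finset.mul_sum]; exact Finset.sum_congr rfl fun m _ => by ring
    rw [h5]
    linear_combination c * p * h1 - p * (∑ m ∈ Finset.range K, y ^ m * (linProd L a b m).coeff m) * hc
  | add p q hp hq =>
    simp only [add_mul, Polynomial.coeff_add, mul_add, Finset.sum_add_distrib, hp, hq,
      Polynomial.eval_add]
  | monomial n p ih =>
    have h := sum_coeff_X_mul_linProd y L a b K hy (C p * X ^ n)
    rw [ih] at h
    have e : (C p * X ^ (n + 1) : A[X]) = X * (C p * X ^ n) := by ring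
    rw [e, Polynomial.eval_mul, Polynomial.eval_X]
    set G := ∑ m ∈ Finset.range K, y ^ m * (X * (C p * X ^ n) * linProd L a b m).coeff m
    linear_combination c * h - G * hc

end Functional

theorem finSuccEquiv_rowForm {S : Type*} [CommRing S] {N : ℕ}
    (A : Matrix (Fin (N + 1)) (Fin (N + 1)) S) (f : Fin (N + 1)) :
    MvPolynomial.finSuccEquiv S N (rowForm A f)
      = Polynomial.C (∑ g : Fin N, MvPolynomial.C (A f g.succ) * MvPolynomial.X g)
        + Polynomial.C (MvPolynomial.C (A f 0)) * Polynomial.X := by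
  have hC : ∀ a : S, MvPolynomial.finSuccEquiv S N (MvPolynomial.C a)
      = Polynomial.C (MvPolynomial.C a) := fun a =>
    ((MvPolynomial.finSuccEquiv S N).symm_apply_eq.mp
      (RingHom.congr_fun (MvPolynomial.finSuccEquiv_comp_C_eq_C (R := S) N) a)).symm
  rw [rowForm, map_sum, Fin.sum_univ_succ, map_mul, hC, MvPolynomial.finSuccEquiv_X_zero, add_comm,
    map_sum]
  congr 1
  refine Finset.sum_congr rfl fun g _ => ?_
  rw [map_mul, hC, MvPolynomial.finSuccEquiv_X_succ, map_mul]

/-- The matrix obtained by solving row `0` of `B` for the first variable, with `c` the inverse of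
`1 - B 0 0 * y`, and substituting the solution into the other rows of `A`. -/
def elimMatrix {S : Type*} [CommRing S] {N : ℕ} (A B : Matrix (Fin (N + 1)) (Fin (N + 1)) S)
    (y c : S) : Matrix (Fin N) (Fin N) S :=
  fun f g => A f.succ g.succ + A f.succ 0 * (y * c) * B 0 g.succ

theorem eval_finSuccEquiv_rowForm {S : Type*} [CommRing S] {N : ℕ}
    (A B : Matrix (Fin (N + 1)) (Fin (N + 1)) S) (y c : S) (f : Fin N) :
    Polynomial.eval (MvPolynomial.C y * (∑ g : Fin N, MvPolynomial.C (B 0 g.succ) *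
        MvPolynomial.X g) * MvPolynomial.C c)
      (MvPolynomial.finSuccEquiv S N (rowForm A f.succ)) = rowForm (elimMatrix A B y c) f := by
  rw [finSuccEquiv_rowForm, Polynomial.eval_add, Polynomial.eval_mul, Polynomial.eval_C,
    Polynomial.eval_C, Polynomial.eval_X, rowForm, Finset.mul_sum, Finset.sum_mul, Finset.mul_sum,
    ← Finset.sum_add_distrib]
  refine Finset.sum_congr rfl fun g _ => ?_
  simp only [elimMatrix, map_add, map_mul]
  ring

/-- Elimination of the first letter in MacMahon's master theorem. -/
theorem masterSum_succ {S : Type*} [CommRing S] (K : ℕ) {N : ℕ}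
    (A B : Matrix (Fin (N + 1)) (Fin (N + 1)) S) (y : Fin (N + 1) → S) (c : S)
    (hAB : ∀ f g, f ≠ g → A f g = B f g) (hy : y 0 ^ K = 0) (hc : c * (1 - B 0 0 * y 0) = 1) :
    masterSum K A B y = c * (1 - (B 0 0 - A 0 0) * y 0) *
      masterSum K (elimMatrix A B (y 0) c) (elimMatrix B B (y 0) c) (fun i => y i.succ) := by
  classical
  -- The off-diagonal part of row `0`. It is common to `A` and `B` by `hAB`, so the row is a
  -- `linProd` in the first variable; substituting `y L c` for that variable in the other rows gives
  -- the eliminated matrices.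
  set L : MvPolynomial (Fin N) S := ∑ g : Fin N, MvPolynomial.C (B 0 g.succ) * MvPolynomial.X g
    with hL
  have hrow0 : ∀ m, MvPolynomial.finSuccEquiv S N (rowProd A B 0 m)
      = linProd L (MvPolynomial.C (A 0 0)) (MvPolynomial.C (B 0 0)) m := by
    intro m
    cases m with
    | zero => simp [rowProd, linProd]
    | succ m =>
      have : ∑ g : Fin N, MvPolynomial.C (A 0 g.succ) * MvPolynomial.X g = L :=
        Finset.sum_congr rfl fun g _ => by rw [hAB 0 g.succ (Fin.succ_ne_zero g).symm]
      rw [rowProd, linProd, map_mul, map_pow, finSuccEquiv_rowForm, finSuccEquiv_rowForm, this]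
  have hrow : ∀ (f : Fin N) (m : ℕ), Polynomial.eval (MvPolynomial.C (y 0) * L * MvPolynomial.C c)
      (MvPolynomial.finSuccEquiv S N (rowProd A B f.succ m))
      = rowProd (elimMatrix A B (y 0) c) (elimMatrix B B (y 0) c) f m := by
    intro f m
    cases m with
    | zero => simp [rowProd]
    | succ m =>
      rw [rowProd, rowProd, map_mul, map_pow, Polynomial.eval_mul, Polynomial.eval_pow,
        eval_finSuccEquiv_rowForm, eval_finSuccEquiv_rowForm]
  rw [masterSum, ← (Fin.consEquiv (fun _ : Fin (N + 1) => Fin K)).sum_comp, Fintype.sum_prod_type,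
    Finset.sum_comm, masterSum, Finset.mul_sum]
  refine Finset.sum_congr rfl fun m _ => ?_
  have hcoef := sum_coeff_linProd (A := MvPolynomial (Fin N) S) (MvPolynomial.C (y 0)) L
    (MvPolynomial.C (A 0 0)) (MvPolynomial.C (B 0 0)) (MvPolynomial.C c) K
    (by rw [← map_pow, hy, map_zero])
    (by rw [← map_mul, ← MvPolynomial.C_1, ← map_sub, ← map_mul, hc])
    (∏ f : Fin N, MvPolynomial.finSuccEquiv S N (rowProd A B f.succ (m f)))
  rw [Polynomial.eval_prod] at hcoef
  simp only [hrow] at hcoef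
  have hcoef' := congrArg (MvPolynomial.coeff (Finsupp.equivFunOnFinite.symm fun f => (m f : ℕ)))
    hcoef
  rw [← Fin.sum_univ_eq_sum_range (fun k => MvPolynomial.C (y 0) ^ k * Polynomial.coeff
    ((∏ f : Fin N, MvPolynomial.finSuccEquiv S N (rowProd A B f.succ (m f))) *
      linProd L (MvPolynomial.C (A 0 0)) (MvPolynomial.C (B 0 0)) k) k) K,
    MvPolynomial.coeff_sum] at hcoef'
  simp only [← MvPolynomial.C_1, ← map_sub, ← map_mul, ← map_pow, MvPolynomial.coeff_C_mul] at hcoef'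
  rw [mul_left_comm, ← hcoef', Finset.mul_sum]
  refine Finset.sum_congr rfl fun k _ => ?_
  have hfin : (Finsupp.equivFunOnFinite.symm fun f =>
      (((Fin.consEquiv (fun _ : Fin (N + 1) => Fin K)) (k, m) f : Fin K) : ℕ))
      = Finsupp.cons (k : ℕ) (Finsupp.equivFunOnFinite.symm fun f => (m f : ℕ)) := by
    ext f
    induction f using Fin.cases <;> simp [Fin.consEquiv]
  rw [hfin, ← MvPolynomial.finSuccEquiv_coeff_coeff, Fin.prod_univ_succ, Fin.prod_univ_succ,
    map_mul, map_prod]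
  simp only [Fin.consEquiv, Equiv.coe_fn_mk, Fin.cons_zero, Fin.cons_succ, hrow0]
  rw [mul_comm (linProd _ _ _ _)]
  ring

/-! ### The matrices of admissible words and their generating function -/

/-- The common part of the matrices encoding which letters may stand in which rows. The letter `g`
has type `κ g`; `u` deforms the columns of type `1`. -/
def offEntry {S : Type*} [CommRing S] (κ : ℕ → Fin 3) (u : S) (f g : ℕ) : S :=
  if κ f = 2 then 0 else if κ g = 0 then (if g < f then 1 else 0)
    else if κ g = 1 then (if f < g then 1 else 0) + u else 0

/-- The matrix for the special position (first or last) of a row. -/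
def specialMatrix {S : Type*} [CommRing S] (N : ℕ) (κ : ℕ → Fin 3) (u : S) :
    Matrix (Fin N) (Fin N) S :=
  fun f g => offEntry κ u f g + if (f : ℕ) = g ∧ κ f = 2 then 1 else 0

/-- The matrix for the other positions of a row. -/
def ordinaryMatrix {S : Type*} [CommRing S] (N : ℕ) (κ : ℕ → Fin 3) (u : S) :
    Matrix (Fin N) (Fin N) S :=
  fun f g => offEntry κ u f g + if (f : ℕ) = g then 1 else 0

/-- The generating function of admissible words over the first `N` letters. -/
noncomputable def wordSum {S : Type*} [CommRing S] (K N : ℕ) (κ : ℕ → Fin 3) (y : ℕ → S) (u : S) :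
    S :=
  masterSum K (specialMatrix N κ u) (ordinaryMatrix N κ u) (fun i => y i)

theorem specialMatrix_eq_ordinaryMatrix {S : Type*} [CommRing S] (N : ℕ) (κ : ℕ → Fin 3) (u : S)
    (f g : Fin N) (h : f ≠ g) : specialMatrix N κ u f g = ordinaryMatrix N κ u f g := by
  simp [specialMatrix, ordinaryMatrix, Fin.val_inj, h]

/-- The value of the deformation parameter after the elimination of a letter of type `k`. -/
def nextParam {S : Type*} [CommRing S] (k : Fin 3) (u y c : S) : S :=
  if k = 0 then u + y * c * (1 + u) else if k = 1 then u + u * (y * c) * (1 + u) else u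

/-- The eliminated letter is the smallest, so off the diagonal its row is nonzero at most in columns
of type `1`, with entry `1 + u`; its column is constant on the rows not of type `2` and zero on the
others. The correction is therefore a shift of `u`. -/
theorem offEntry_succ {S : Type*} [CommRing S] (κ : ℕ → Fin 3) (u y c : S) (f g : ℕ) :
    offEntry κ u (f + 1) (g + 1) + offEntry κ u (f + 1) 0 * (y * c) * offEntry κ u 0 (g + 1)
      = offEntry (fun i => κ (i + 1)) (nextParam (κ 0) u y c) f g := by
  have h3 : ∀ k : Fin 3, k = 0 ∨ k = 1 ∨ k = 2 := by decide
  rcases h3 (κ 0) with h | h | h <;> rcases h3 (κ (f + 1)) with h' | h' | h' <;>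
    rcases h3 (κ (g + 1)) with h'' | h'' | h'' <;>
    simp [offEntry, nextParam, h, h', h''] <;> ring

theorem elimMatrix_specialMatrix {S : Type*} [CommRing S] (N : ℕ) (κ : ℕ → Fin 3) (u y c : S) :
    elimMatrix (specialMatrix (N + 1) κ u) (ordinaryMatrix (N + 1) κ u) y c
      = specialMatrix N (fun i => κ (i + 1)) (nextParam (κ 0) u y c) := by
  ext f g
  simp only [elimMatrix, specialMatrix, ordinaryMatrix, Fin.val_succ, Fin.val_zero,
    ← offEntry_succ]
  simp
  ring

theorem elimMatrix_ordinaryMatrix {S : Type*} [CommRing S] (N : ℕ) (κ : ℕ → Fin 3) (u y c : S) :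
    elimMatrix (ordinaryMatrix (N + 1) κ u) (ordinaryMatrix (N + 1) κ u) y c
      = ordinaryMatrix N (fun i => κ (i + 1)) (nextParam (κ 0) u y c) := by
  ext f g
  simp only [elimMatrix, ordinaryMatrix, Fin.val_succ, Fin.val_zero, ← offEntry_succ]
  simp
  ring

/-- The special and ordinary diagonal entries differ by `1`, except at type `2`, where they agree;
this gives the middle factor. -/
theorem wordSum_succ {S : Type*} [CommRing S] (K N : ℕ) (κ : ℕ → Fin 3) (y : ℕ → S) (u c : S)
    (hy : y 0 ^ K = 0) (hc : c * (1 - (offEntry κ u 0 0 + 1) * y 0) = 1) :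
    wordSum K (N + 1) κ y u = c * (1 - (if κ 0 = 2 then 0 else y 0)) *
      wordSum K N (fun i => κ (i + 1)) (fun i => y (i + 1)) (nextParam (κ 0) u (y 0) c) := by
  have hB : ordinaryMatrix (N + 1) κ u 0 0 = offEntry κ u 0 0 + 1 := by simp [ordinaryMatrix]
  have hA : specialMatrix (N + 1) κ u 0 0 = offEntry κ u 0 0 + if κ 0 = 2 then 1 else 0 := by
    simp [specialMatrix]
  rw [wordSum, masterSum_succ K _ _ _ c (specialMatrix_eq_ordinaryMatrix (N + 1) κ u)
    (by simpa using hy) (by rw [hB]; simpa using hc), hA, hB, Fin.val_zero,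
    elimMatrix_specialMatrix, elimMatrix_ordinaryMatrix, wordSum]
  congr 2
  split_ifs <;> ring

theorem exists_mul_one_sub_eq_one {S : Type*} [CommRing S] {y : S} {K : ℕ} (hy : y ^ K = 0) (b : S) :
    ∃ c, c * (1 - b * y) = 1 := by
  have h : IsNilpotent (b * y) := ⟨K, by rw [mul_pow, hy, mul_zero]⟩
  obtain ⟨c, hc⟩ := h.isUnit_one_sub.exists_left_inv
  exact ⟨c, hc⟩

/-- The types of the letters: they come in triples. -/
def tripleKind (i : ℕ) : Fin 3 := ⟨i % 3, Nat.mod_lt _ (by norm_num)⟩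

/-- The weights of the letters of the `i / 3`-th triple. -/
def tripleWeight {S : Type*} [CommRing S] (T r : S) (x : ℕ → S) (i : ℕ) : S :=
  (if tripleKind i = 0 then T else if tripleKind i = 1 then 1 else r) * x (i / 3)

/-- Eliminating one triple replaces `w = 1 + u` by `w2`. The bracket is affine in `w` and reproduces
itself up to the factors `1 - w1 x` and `1 - T x`, which the inverses `c1` and `c0` cancel.
Denominators stay cleared since `1 - T`, the bracket at `x = 0`, need not be invertible. -/
theorem wordSum_triple {S : Type*} [CommRing S] (K : ℕ) (T r : S) (M : ℕ) (x : ℕ → S)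
    (hx : ∀ i, x i ^ K = 0) (w : S) :
    wordSum K (3 * M) tripleKind (tripleWeight T r x) (w - 1) *
      (∏ i ∈ Finset.range M, (1 - r * x i)) *
      (w * ∏ i ∈ Finset.range M, (1 - x i) + (1 - T - w) * ∏ i ∈ Finset.range M, (1 - T * x i))
      = (1 - T) * ((∏ i ∈ Finset.range M, (1 - T * x i)) * ∏ i ∈ Finset.range M, (1 - x i)) := by
  induction M generalizing x w with
  | zero =>
    have h : ∀ m : Fin (3 * 0) →₀ ℕ,
        MvPolynomial.coeff m (1 : MvPolynomial (Fin (3 * 0)) S) = 1 := fun m => by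
      rw [MvPolynomial.coeff_one, if_pos (Finsupp.ext fun i => i.elim0)]
    simp [wordSum, masterSum, h]
  | succ M ih =>
    have k0 : tripleKind 0 = 0 := rfl
    have k1 : tripleKind (0 + 1) = 1 := rfl
    have k2 : tripleKind (0 + 1 + 1) = 2 := rfl
    have hTx : ∀ a : S, (a * x 0) ^ K = 0 := fun a => by rw [mul_pow, hx, mul_zero]
    have y0 : tripleWeight T r x 0 = T * x 0 := by simp [tripleWeight, k0]
    have y1 : tripleWeight T r x (0 + 1) = x 0 := by
      rw [tripleWeight, k1]; simp
    have y2 : tripleWeight T r x (0 + 1 + 1) = r * x 0 := by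
      rw [tripleWeight, k2]; simp
    obtain ⟨c0, hc0⟩ := exists_mul_one_sub_eq_one (hTx T) 1
    set w1 := w * c0 with hw1
    obtain ⟨c1, hc1⟩ := exists_mul_one_sub_eq_one (hx 0) w1
    obtain ⟨c2, hc2⟩ := exists_mul_one_sub_eq_one (hTx r) 1
    set w2 := w1 * c1 * (1 - x 0) with hw2
    have hu1 : nextParam 0 (w - 1) (T * x 0) c0 = w1 - 1 := by
      simp only [nextParam, if_true]
      linear_combination -w * hc0
    have hu2 : nextParam 1 (w1 - 1) (x 0) c1 = w2 - 1 := by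
      simp only [nextParam, if_true, one_ne_zero, if_false]
      linear_combination -w1 * hc1
    have hu3 : nextParam 2 (w2 - 1) (r * x 0) c2 = w2 - 1 := by
      simp [nextParam]
    have e : wordSum K (3 * (M + 1)) tripleKind (tripleWeight T r x) (w - 1)
        = wordSum K (3 * M + 1 + 1 + 1) tripleKind (tripleWeight T r x) (w - 1) := rfl
    have hk : (fun i => tripleKind (i + 1 + 1 + 1)) = tripleKind := by
      funext i; exact Fin.ext (Nat.add_mod_right i 3)
    have hyy : (fun i => tripleWeight T r x (i + 1 + 1 + 1))
        = tripleWeight T r (fun i => x (i + 1)) := by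
      funext i
      simp only [tripleWeight, congrFun hk i, show (i + 1 + 1 + 1) / 3 = i / 3 + 1 by omega]
    rw [e, wordSum_succ K _ _ _ _ c0 (by rw [y0, hTx]) (by simpa [offEntry, k0, y0] using hc0),
      wordSum_succ K _ _ _ _ c1 (by rw [y1, hx]) (by
        simp only [k0, y0, hu1]; simp only [offEntry, k1, y1]; simpa using hc1),
      wordSum_succ K _ _ _ _ c2 (by rw [y2, hTx]) (by
        simp only [offEntry, k2, y2]; simpa using hc2)]
    simp only [k0, k1, k2, y0, y1, y2, hu1, hu2, hu3, hk, hyy]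
    have ih' := ih (fun i => x (i + 1)) (fun i => hx _) w2
    rw [Finset.prod_range_succ', Finset.prod_range_succ', Finset.prod_range_succ']
    set Z := wordSum K (3 * M) tripleKind (tripleWeight T r fun i => x (i + 1)) (w2 - 1)
    set P := ∏ i ∈ Finset.range M, (1 - x (i + 1))
    set Q := ∏ i ∈ Finset.range M, (1 - T * x (i + 1))
    set F := ∏ i ∈ Finset.range M, (1 - r * x (i + 1))
    have hw1' : w1 * (1 - T * x 0) = w := by rw [hw1]; linear_combination w * hc0
    have hw2' : w2 * (1 - w1 * x 0) = w1 * (1 - x 0) := by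
      rw [hw2]; linear_combination w1 * (1 - x 0) * hc1
    have hlin : w * (P * (1 - x 0)) + (1 - T - w) * (Q * (1 - T * x 0))
        = (1 - w1 * x 0) * (1 - T * x 0) * (w2 * P + (1 - T - w2) * Q) := by
      linear_combination -((1 - x 0) * (P - Q) - (1 - T) * Q * x 0) * hw1' -
        (1 - T * x 0) * (P - Q) * hw2'
    rw [hlin]
    simp only [if_neg (show (0 : Fin 3) ≠ 2 by decide), if_neg (show (1 : Fin 3) ≠ 2 by decide),
      if_true, sub_zero, mul_one]
    have h0 : c0 * (1 - T * x 0) = 1 := by simpa using hc0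
    have h2 : c2 * (1 - r * x 0) = 1 := by simpa using hc2
    calc _ = (c0 * (1 - T * x 0)) * (c1 * (1 - w1 * x 0)) * (c2 * (1 - r * x 0)) *
          (1 - x 0) * (1 - T * x 0) * (Z * F * (w2 * P + (1 - T - w2) * Q)) := by ring
      _ = _ := by rw [h0, hc1, h2, ih']; ring

/-! ### Words and their contents -/

/-- The number of occurrences of each letter in a word. -/
def content {n N : ℕ} (g : Fin n → Fin N) (f : Fin N) : ℕ :=
  (Finset.univ.filter fun i => g i = f).card

theorem card_filter_le_eq_sum_content {n N : ℕ} (g : Fin n → Fin N) (a : Fin N) :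
    (Finset.univ.filter fun i => g i ≤ a).card
      = ∑ f ∈ Finset.univ.filter (· ≤ a), content g f := by
  rw [Finset.card_eq_sum_card_fiberwise (f := g) (t := Finset.univ.filter (· ≤ a))
    (fun i hi => by simpa using hi)]
  refine Finset.sum_congr rfl fun f hf => ?_
  rw [content, Finset.filter_filter]
  congr 1
  ext i
  simp only [Finset.mem_filter, Finset.mem_univ, true_and] at hf ⊢
  exact ⟨fun h => h.2, fun h => ⟨h ▸ hf, h⟩⟩

theorem eq_of_monotone_of_content_eq {n N : ℕ} {φ ψ : Fin n → Fin N} (hφ : Monotone φ)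
    (hψ : Monotone ψ) (h : content φ = content ψ) : φ = ψ := by
  have key : ∀ i a, φ i ≤ a ↔ ψ i ≤ a := fun i a => by
    rw [← Tuple.lt_card_le_iff_apply_le_of_monotone hφ,
      ← Tuple.lt_card_le_iff_apply_le_of_monotone hψ]
    have e1 := card_filter_le_eq_sum_content φ a
    have e2 := card_filter_le_eq_sum_content ψ a
    rw [h] at e1
    rw [e1, e2]
  funext i
  exact le_antisymm ((key i _).2 le_rfl) ((key i _).1 le_rfl)

theorem content_comp_perm {n N : ℕ} (g : Fin n → Fin N) (σ : Equiv.Perm (Fin n)) :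
    content (g ∘ σ) = content g := by
  funext f
  exact Finset.card_bij (fun i _ => σ i) (by simp) (by simp)
    (fun j hj => ⟨σ.symm j, by simpa using hj⟩)

theorem sum_content {n N : ℕ} (g : Fin n → Fin N) : ∑ f, content g f = n := by
  have := Finset.card_eq_sum_card_fiberwise (s := (Finset.univ : Finset (Fin n))) (f := g)
    (t := Finset.univ) (by simp)
  simpa [content] using this.symm

theorem exists_monotone_content_eq {n N : ℕ} (m : Fin N → ℕ) (hm : ∑ f, m f = n) :
    ∃ φ : Fin n → Fin N, Monotone φ ∧ content φ = m := by
  subst hm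
  let w : Fin (∑ f, m f) → Fin N := fun i => (finSigmaFinEquiv.symm i).1
  refine ⟨w ∘ Tuple.sort w, Tuple.monotone_sort w, ?_⟩
  rw [content_comp_perm]
  funext f
  rw [content, ← Fintype.card_fin (m f), ← Finset.card_univ]
  refine (Finset.card_bij (fun k _ => finSigmaFinEquiv ⟨f, k⟩) ?_ ?_ ?_).symm
  · intro k _
    rw [Finset.mem_filter]
    exact ⟨Finset.mem_univ _, congrArg Sigma.fst (finSigmaFinEquiv.symm_apply_apply _)⟩
  · intro k _ l _ h
    exact eq_of_heq (Sigma.mk.inj (finSigmaFinEquiv.injective h)).2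
  · intro i hi
    obtain rfl := (Finset.mem_filter.1 hi).2
    exact ⟨(finSigmaFinEquiv.symm i).2, Finset.mem_univ _, finSigmaFinEquiv.apply_symm_apply i⟩

theorem prod_pow_content {S : Type*} [CommMonoid S] {n N : ℕ} (g : Fin n → Fin N) (y : Fin N → S) :
    ∏ f, y f ^ content g f = ∏ i, y (g i) := by
  rw [← Finset.prod_fiberwise (Finset.univ : Finset (Fin n)) g (fun i => y (g i))]
  refine Finset.prod_congr rfl fun f _ => ?_
  rw [content, ← Finset.prod_const]
  exact Finset.prod_congr rfl fun i hi => by rw [(Finset.mem_filter.1 hi).2]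

theorem coeff_prod_linearForm {S : Type*} [CommRing S] {n N : ℕ} (m : Fin N → ℕ)
    (c : Fin n → Fin N → S) :
    MvPolynomial.coeff (Finsupp.equivFunOnFinite.symm m)
      (∏ i, ∑ g, MvPolynomial.C (c i g) * MvPolynomial.X g)
      = ∑ g : Fin n → Fin N, if content g = m then ∏ i, c i (g i) else 0 := by
  classical
  rw [Finset.prod_univ_sum, Fintype.piFinset_univ, MvPolynomial.coeff_sum]
  refine Finset.sum_congr rfl fun g _ => ?_
  rw [Finset.prod_mul_distrib, ← map_prod, MvPolynomial.coeff_C_mul, ← prod_pow_content g,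
    MvPolynomial.coeff_prod_X_pow]
  have : Finsupp.equivFunOnFinite.symm m
      = Finsupp.indicator Finset.univ (fun f _ => content g f) ↔ content g = m := by
    rw [Finsupp.ext_iff, funext_iff]
    exact forall_congr' fun f => by simp [eq_comm]
  simp only [this, mul_ite, mul_one, mul_zero]

/-! ### Admissible pairs and sorting -/

/-- The special position of a block of equal letters of `φ`: the last one if the letter has type
`1`, the first one otherwise. -/
def IsSpecial {n N : ℕ} (κ : ℕ → Fin 3) (φ : Fin n → Fin N) (j : Fin n) : Prop :=
  if κ (φ j) = 1 then ∀ k, j < k → φ k ≠ φ j else ∀ k, k < j → φ k ≠ φ j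

theorem existsUnique_isSpecial {n N : ℕ} (κ : ℕ → Fin 3) (φ : Fin n → Fin N) (i : Fin n) :
    ∃ j, φ j = φ i ∧ IsSpecial κ φ j ∧ ∀ k, φ k = φ i → IsSpecial κ φ k → k = j := by
  have hne : (Finset.univ.filter fun j => φ j = φ i).Nonempty := ⟨i, by simp⟩
  by_cases h : κ (φ i) = 1
  · refine ⟨_, (Finset.mem_filter.1 (Finset.max'_mem _ hne)).2, ?_, ?_⟩
    · rw [IsSpecial, (Finset.mem_filter.1 (Finset.max'_mem _ hne)).2, if_pos h]
      intro k hk hk'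
      exact absurd (Finset.le_max' _ k (by simpa using hk')) (not_le.2 hk)
    · intro k hk hs
      rw [IsSpecial, hk, if_pos h] at hs
      refine le_antisymm (Finset.le_max' _ k (by simpa using hk)) (not_lt.1 fun hlt => ?_)
      exact hs _ hlt (Finset.mem_filter.1 (Finset.max'_mem _ hne)).2
  · refine ⟨_, (Finset.mem_filter.1 (Finset.min'_mem _ hne)).2, ?_, ?_⟩
    · rw [IsSpecial, (Finset.mem_filter.1 (Finset.min'_mem _ hne)).2, if_neg h]
      intro k hk hk'
      exact absurd (Finset.min'_le _ k (by simpa using hk')) (not_le.2 hk)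
    · intro k hk hs
      rw [IsSpecial, hk, if_neg h] at hs
      refine le_antisymm (not_lt.1 fun hlt => ?_) (Finset.min'_le _ k (by simpa using hk))
      exact hs _ hlt (Finset.mem_filter.1 (Finset.min'_mem _ hne)).2

open Classical in
theorem prod_rowProd_content {S : Type*} [CommRing S] {n N : ℕ} (A B : Matrix (Fin N) (Fin N) S)
    (κ : ℕ → Fin 3) (φ : Fin n → Fin N) :
    ∏ f, rowProd A B f (content φ f)
      = ∏ i, rowForm (if IsSpecial κ φ i then A else B) (φ i) := by
  rw [← Finset.prod_fiberwise (Finset.univ : Finset (Fin n)) φ]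
  refine Finset.prod_congr rfl fun f _ => ?_
  rcases (Finset.univ.filter fun i => φ i = f).eq_empty_or_nonempty with h | ⟨i, hi⟩
  · rw [content, h]; simp [rowProd]
  · obtain rfl := (Finset.mem_filter.1 hi).2
    obtain ⟨j, hj, hs, hu⟩ := existsUnique_isSpecial κ φ i
    have hjm : j ∈ Finset.univ.filter fun k => φ k = φ i := by simpa using hj
    rw [← Finset.mul_prod_erase _ _ hjm, if_pos hs, hj, content,
      ← Finset.card_erase_add_one hjm, rowProd, ← Finset.prod_const]
    congr 1
    refine Finset.prod_congr rfl fun k hk => ?_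
    obtain ⟨h1, h2⟩ := Finset.mem_erase.1 hk
    have h3 := (Finset.mem_filter.1 h2).2
    rw [if_neg (fun h => h1 (hu k h3 h)), h3]

/-- `σ` increases on the blocks of equal letters of `φ`. -/
def IncreasesOnBlocks {n N : ℕ} (σ : Equiv.Perm (Fin n)) (φ : Fin n → Fin N) : Prop :=
  ∀ i j, i < j → φ i = φ j → σ i < σ j

/-- Blocks of a monotone word are intervals, and `σ` gains at least one per step there, so an excess
`σ s - s ≥ c` propagates to the right. -/
theorem IncreasesOnBlocks.add_le {n N : ℕ} {σ : Equiv.Perm (Fin n)} {φ : Fin n → Fin N}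
    (hσ : IncreasesOnBlocks σ φ) (hφ : Monotone φ) {s k : Fin n} {c : ℕ} (hs : (s : ℕ) + c ≤ σ s)
    (hsk : s ≤ k) (hk : φ k = φ s) : (k : ℕ) + c ≤ σ k := by
  obtain ⟨d, hd⟩ := Nat.exists_eq_add_of_le (Fin.le_def.1 hsk)
  induction d generalizing k with
  | zero => obtain rfl : k = s := Fin.ext (by simpa using hd)
            exact hs
  | succ d ih =>
    have hk' : (s : ℕ) + d < n := by have := k.isLt; omega
    have h1 : s ≤ (⟨s + d, hk'⟩ : Fin n) := Fin.le_def.2 (by simp)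
    have h2 : (⟨s + d, hk'⟩ : Fin n) < k := Fin.lt_def.2 (by simp; omega)
    have h3 : φ ⟨s + d, hk'⟩ = φ s := le_antisymm (hk ▸ hφ h2.le) (hφ h1)
    have h4 := ih h1 h3 rfl
    have h5 := Fin.lt_def.1 (hσ _ _ h2 (h3.trans hk.symm))
    simp only at h4
    omega

theorem IncreasesOnBlocks.le_add {n N : ℕ} {σ : Equiv.Perm (Fin n)} {φ : Fin n → Fin N}
    (hσ : IncreasesOnBlocks σ φ) (hφ : Monotone φ) {s k : Fin n} {c : ℕ} (hs : (σ s : ℕ) + c ≤ s)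
    (hsk : k ≤ s) (hk : φ k = φ s) : (σ k : ℕ) + c ≤ k := by
  obtain ⟨d, hd⟩ := Nat.exists_eq_add_of_le (Fin.le_def.1 hsk)
  induction d generalizing k with
  | zero => obtain rfl : k = s := Fin.ext (by simpa using hd.symm)
            exact hs
  | succ d ih =>
    have hk' : (k : ℕ) + 1 < n := by have := s.isLt; omega
    have h1 : (⟨k + 1, hk'⟩ : Fin n) ≤ s := Fin.le_def.2 (by simp; omega)
    have h2 : k < (⟨k + 1, hk'⟩ : Fin n) := Fin.lt_def.2 (by simp)
    have h3 : φ ⟨k + 1, hk'⟩ = φ s := le_antisymm (hφ h1) (hk ▸ hφ h2.le)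
    have h4 := ih h1 h3 (by simp; omega)
    have h5 := Fin.lt_def.1 (hσ _ _ h2 (hk.trans h3.symm))
    simp only at h4
    omega

/-- The letter `φ i` may stand at position `σ i`. -/
def Allowed {n N : ℕ} (κ : ℕ → Fin 3) (σ : Equiv.Perm (Fin n)) (φ : Fin n → Fin N) (i : Fin n) :
    Prop :=
  (φ (σ i) = φ i ∧ (κ (φ i) = 2 ∨ ¬ IsSpecial κ φ (σ i))) ∨
    (κ (φ (σ i)) ≠ 2 ∧ κ (φ i) = 0 ∧ φ i < φ (σ i)) ∨
    (κ (φ (σ i)) ≠ 2 ∧ κ (φ i) = 1 ∧ φ (σ i) < φ i)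

theorem kind_eq_zero {n : ℕ} {σ : Equiv.Perm (Fin n)} {i : Fin n} : kind σ i = 0 ↔ i < σ i := by
  rcases lt_trichotomy i (σ i) with h | h | h
  · simp [kind, h]
  · simp [kind, ← h]
  · simp [kind, h, h.not_gt]

theorem kind_eq_one {n : ℕ} {σ : Equiv.Perm (Fin n)} {i : Fin n} : kind σ i = 1 ↔ σ i < i := by
  rcases lt_trichotomy i (σ i) with h | h | h
  · simp [kind, h, h.not_gt]
  · simp [kind, ← h]
  · simp [kind, h, h.not_gt]

theorem kind_eq_two {n : ℕ} {σ : Equiv.Perm (Fin n)} {i : Fin n} : kind σ i = 2 ↔ σ i = i := by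
  rcases lt_trichotomy i (σ i) with h | h | h
  · simp [kind, h, h.ne']
  · simp [kind, ← h]
  · simp [kind, h, h.not_gt, h.ne]

theorem eq_zero_or_one_or_two (k : Fin 3) : k = 0 ∨ k = 1 ∨ k = 2 := by
  revert k; decide

/-- On a block of type `0` all positions are excedances as soon as the first one is, and dually for
type `1` with the last one; forbidding the block's own letter at the special position excludes
exactly the failure `σ s = s`. A block of type `2` is mapped into itself increasingly, hence
pointwise fixed. -/
theorem forall_allowed_iff {n N : ℕ} (κ : ℕ → Fin 3) {σ : Equiv.Perm (Fin n)} {φ : Fin n → Fin N}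
    (hσ : IncreasesOnBlocks σ φ) (hφ : Monotone φ) :
    (∀ i, Allowed κ σ φ i) ↔ ∀ i, κ (φ i) = kind σ i := by
  have hlt : ∀ {i j}, φ i < φ j → i < j := fun h => not_le.1 fun h' => (hφ h').not_gt h
  constructor
  · intro h i
    obtain ⟨s, hs, hsp, -⟩ := existsUnique_isSpecial κ φ i
    have hsA := h s
    rw [Allowed, hs] at hsA
    rw [IsSpecial, hs] at hsp
    rcases eq_zero_or_one_or_two (κ (φ i)) with hk | hk | hk
    · rw [hk, eq_comm, kind_eq_zero]
      simp only [hk, Fin.isValue] at hsA hsp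
      rw [if_neg (by decide)] at hsp
      have hsi : s ≤ i := not_lt.1 fun h' => hsp i h' rfl
      have h1 : s < σ s := by
        rcases hsA with ⟨h1, h2⟩ | ⟨-, -, h2⟩ | ⟨-, h2, -⟩
        · rcases h2 with h2 | h2
          · exact absurd h2 (by decide)
          · refine lt_of_le_of_ne (not_lt.1 fun h' => hsp _ h' h1) fun h' => h2 ?_
            rw [← h', IsSpecial, hs, hk, if_neg (by decide)]
            exact hsp
        · exact hlt (hs ▸ h2)
        · exact absurd h2 (by decide)
      exact hσ.add_le hφ (c := 1) h1 hsi hs.symm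
    · rw [hk, eq_comm, kind_eq_one]
      simp only [hk, Fin.isValue, if_true] at hsA hsp
      have hsi : i ≤ s := not_lt.1 fun h' => hsp i h' rfl
      have h1 : σ s < s := by
        rcases hsA with ⟨h1, h2⟩ | ⟨-, h2, -⟩ | ⟨-, -, h2⟩
        · rcases h2 with h2 | h2
          · exact absurd h2 (by decide)
          · refine lt_of_le_of_ne (not_lt.1 fun h' => hsp _ h' h1) fun h' => h2 ?_
            rw [h', IsSpecial, hs, hk, if_pos rfl]
            exact hsp
        · exact absurd h2 (by decide)
        · exact hlt (hs ▸ h2)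
      exact hσ.le_add hφ (c := 1) h1 hsi hs.symm
    · rw [hk, eq_comm, kind_eq_two]
      have hin : ∀ j, φ j = φ i → φ (σ j) = φ i := fun j hj => by
        have hj' := h j
        rw [Allowed, hj, hk] at hj'
        rcases hj' with h' | ⟨-, h', -⟩ | ⟨-, h', -⟩
        · exact h'.1
        · exact absurd h' (by decide)
        · exact absurd h' (by decide)
      -- With the constant type `1` the special position is the last one of the block.
      obtain ⟨e, he, hep, -⟩ := existsUnique_isSpecial (fun _ => 1) φ i
      rw [IsSpecial, he, if_pos rfl] at hep
      rw [hk, if_neg (by decide)] at hsp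
      have hsi : s ≤ i := not_lt.1 fun h' => hsp i h' rfl
      have hie : i ≤ e := not_lt.1 fun h' => hep i h' rfl
      have h1 : s ≤ σ s := not_lt.1 fun h' => hsp _ h' (hin s hs)
      have h2 : σ e ≤ e := not_lt.1 fun h' => hep _ h' (hin e he)
      exact le_antisymm (hσ.le_add hφ (c := 0) h2 hie he.symm) (hσ.add_le hφ (c := 0) h1 hsi hs.symm)
  · intro h i
    have h2 : κ (φ (σ i)) = 2 → σ i = i := fun h' => by
      rw [h, kind_eq_two] at h'
      exact σ.injective h'
    rw [Allowed, IsSpecial]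
    rcases eq_zero_or_one_or_two (κ (φ i)) with hk | hk | hk
    · have hi : i < σ i := kind_eq_zero.1 (h i ▸ hk)
      rcases (hφ hi.le).lt_or_eq with h' | h'
      · exact Or.inr (Or.inl ⟨fun h3 => hi.ne' (h2 h3), hk, h'⟩)
      · refine Or.inl ⟨h'.symm, Or.inr ?_⟩
        rw [← h', hk, if_neg (by decide)]
        exact fun h3 => h3 i hi rfl
    · have hi : σ i < i := kind_eq_one.1 (h i ▸ hk)
      rcases (hφ hi.le).lt_or_eq with h' | h'
      · exact Or.inr (Or.inr ⟨fun h3 => hi.ne (h2 h3), hk, h'⟩)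
      · refine Or.inl ⟨h', Or.inr ?_⟩
        rw [h', hk, if_pos rfl]
        exact fun h3 => h3 i hi rfl
    · have hi : σ i = i := kind_eq_two.1 (h i ▸ hk)
      exact Or.inl ⟨by rw [hi], Or.inl hk⟩

open Classical in
theorem matrix_entry_eq {S : Type*} [CommRing S] {n N : ℕ} (κ : ℕ → Fin 3)
    (σ : Equiv.Perm (Fin n)) (φ : Fin n → Fin N) (i : Fin n) :
    (if IsSpecial κ φ (σ i) then specialMatrix N κ (0 : S) else ordinaryMatrix N κ 0)
      (φ (σ i)) (φ i) = if Allowed κ σ φ i then 1 else 0 := by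
  have hval : ((φ (σ i) : ℕ) = φ i) ↔ φ (σ i) = φ i := Fin.val_inj
  rcases lt_trichotomy (φ (σ i)) (φ i) with h | h | h
  · have h1 := h.ne
    have h2 := h.not_gt
    by_cases hs : IsSpecial κ φ (σ i) <;>
      rcases eq_zero_or_one_or_two (κ (φ i)) with hk | hk | hk <;>
      rcases eq_zero_or_one_or_two (κ (φ (σ i))) with hk' | hk' | hk' <;>
      simp [Allowed, specialMatrix, ordinaryMatrix, offEntry, h, h1, h2, hs, hk, hk', hval]
  · by_cases hs : IsSpecial κ φ (σ i) <;>
      rcases eq_zero_or_one_or_two (κ (φ i)) with hk | hk | hk <;>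
      simp [Allowed, specialMatrix, ordinaryMatrix, offEntry, h, hs, hk]
  · have h1 := h.ne'
    have h2 := h.not_gt
    by_cases hs : IsSpecial κ φ (σ i) <;>
      rcases eq_zero_or_one_or_two (κ (φ i)) with hk | hk | hk <;>
      rcases eq_zero_or_one_or_two (κ (φ (σ i))) with hk' | hk' | hk' <;>
      simp [Allowed, specialMatrix, ordinaryMatrix, offEntry, h, h1, h2, hs, hk, hk', hval]

/-- The words `φ` for which `(σ, φ)` arises by sorting an admissible word. -/
def Admissible {n N : ℕ} (κ : ℕ → Fin 3) (σ : Equiv.Perm (Fin n)) (φ : Fin n → Fin N) : Prop :=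
  Monotone φ ∧ IncreasesOnBlocks σ φ ∧ ∀ i, κ (φ i) = kind σ i

theorem eq_sort_of_increasesOnBlocks {n N : ℕ} {σ : Equiv.Perm (Fin n)} {φ : Fin n → Fin N}
    (hφ : Monotone φ) (hσ : IncreasesOnBlocks σ φ) : σ = Tuple.sort (φ ∘ σ.symm) := by
  rw [Tuple.eq_sort_iff]
  constructor
  · rw [Function.comp_assoc]; simpa using hφ
  · intro i j hij h
    exact hσ i j hij (by simpa using h)

-- Expanding the product sums over rearrangements `g` of `φ`. Stable sorting matches them with the
-- permutations increasing on blocks, through `g = φ ∘ σ⁻¹`, and the weight of `g` is the indicator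
-- that every letter is allowed.
open Classical in
theorem coeff_rowProd_content {S : Type*} [CommRing S] {n N : ℕ} (κ : ℕ → Fin 3)
    {φ : Fin n → Fin N} (hφ : Monotone φ) :
    MvPolynomial.coeff (Finsupp.equivFunOnFinite.symm (content φ))
      (∏ f, rowProd (specialMatrix N κ (0 : S)) (ordinaryMatrix N κ 0) f (content φ f))
      = ∑ σ : Equiv.Perm (Fin n), if Admissible κ σ φ then 1 else 0 := by
  let E : Fin n → Fin N → S := fun i =>
    (if IsSpecial κ φ i then specialMatrix N κ (0 : S) else ordinaryMatrix N κ 0) (φ i)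
  have h1 := coeff_prod_linearForm (content φ) E
  rw [prod_rowProd_content _ _ κ φ]
  simp only [rowForm]
  rw [h1, ← Finset.sum_filter]
  have h2 : ∑ σ : Equiv.Perm (Fin n), (if Admissible κ σ φ then (1 : S) else 0)
      = ∑ σ ∈ Finset.univ.filter (fun σ : Equiv.Perm (Fin n) => IncreasesOnBlocks σ φ),
        ∏ i, E i (φ (σ.symm i)) := by
    rw [Finset.sum_filter]
    refine Finset.sum_congr rfl fun σ _ => ?_
    by_cases hσ : IncreasesOnBlocks σ φ
    · rw [if_pos hσ, ← Equiv.prod_comp σ]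
      simp only [Equiv.symm_apply_apply, E]
      rw [Finset.prod_congr rfl fun i _ => matrix_entry_eq κ σ φ i]
      by_cases hall : ∀ i, Allowed κ σ φ i
      · rw [if_pos ⟨hφ, hσ, (forall_allowed_iff κ hσ hφ).1 hall⟩,
          Finset.prod_congr rfl fun i _ => if_pos (hall i), Finset.prod_const_one]
      · rw [if_neg fun h => hall ((forall_allowed_iff κ hσ hφ).2 h.2.2)]
        obtain ⟨i, hi⟩ := not_forall.1 hall
        exact (Finset.prod_eq_zero (Finset.mem_univ i) (if_neg hi)).symm
    · rw [if_neg hσ, if_neg fun h => hσ h.2.1]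
  rw [h2]
  symm
  refine Finset.sum_bij (fun σ _ => φ ∘ σ.symm) ?_ ?_ ?_ ?_
  · intro σ _
    rw [Finset.mem_filter]
    exact ⟨Finset.mem_univ _, content_comp_perm φ σ.symm⟩
  · intro σ hσ τ hτ h
    rw [eq_sort_of_increasesOnBlocks hφ (Finset.mem_filter.1 hσ).2,
      eq_sort_of_increasesOnBlocks hφ (Finset.mem_filter.1 hτ).2]
    exact congrArg Tuple.sort h
  · intro g hg
    have hφg : g ∘ Tuple.sort g = φ :=
      eq_of_monotone_of_content_eq (Tuple.monotone_sort g) hφ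
        ((content_comp_perm g _).trans (Finset.mem_filter.1 hg).2)
    refine ⟨Tuple.sort g, ?_, ?_⟩
    · rw [Finset.mem_filter]
      refine ⟨Finset.mem_univ _, fun i j hij h => ?_⟩
      rw [← hφg] at h
      exact (Tuple.eq_sort_iff.1 rfl).2 i j hij h
    · funext i
      simp [← hφg]
  · intro σ _
    rfl

open Classical in
theorem wordSum_eq_sum_perm {S : Type*} [CommRing S] (K N : ℕ) (κ : ℕ → Fin 3) (z : S)
    (hz : z ^ K = 0) (c : ℕ → S) :
    wordSum K N κ (fun i => z * c i) 0 = ∑ n ∈ Finset.range K, z ^ n *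
      ∑ σ : Equiv.Perm (Fin n), ∑ φ : Fin n → Fin N,
        if Admissible κ σ φ then ∏ i, c (φ i) else 0 := by
  have hsum : ∀ n, ∑ σ : Equiv.Perm (Fin n), ∑ φ : Fin n → Fin N,
        (if Admissible κ σ φ then ∏ i, c (φ i) else 0)
      = ∑ φ ∈ Finset.univ.filter (fun φ : Fin n → Fin N => Monotone φ), (∏ i, c (φ i)) *
        MvPolynomial.coeff (Finsupp.equivFunOnFinite.symm (content φ))
        (∏ f, rowProd (specialMatrix N κ (0 : S)) (ordinaryMatrix N κ 0) f (content φ f)) := by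
    intro n
    rw [Finset.sum_comm, Finset.sum_filter]
    refine Finset.sum_congr rfl fun φ _ => ?_
    split_ifs with hφ
    · rw [coeff_rowProd_content κ hφ, Finset.mul_sum]
      exact Finset.sum_congr rfl fun σ _ => by split_ifs <;> simp
    · exact Finset.sum_eq_zero fun σ _ => if_neg fun h => hφ h.1
  simp only [hsum, Finset.mul_sum]
  rw [Finset.sum_sigma', wordSum, masterSum]
  symm
  have hle : ∀ {n : ℕ} (φ : Fin n → Fin N) f, content φ f ≤ n := fun φ f => by
    simpa [content] using Finset.card_filter_le (Finset.univ : Finset (Fin _)) (fun i => φ i = f)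
  refine Finset.sum_bij_ne_zero (fun a ha _ f => ⟨content a.2 f,
    (hle a.2 f).trans_lt (Finset.mem_range.1 (Finset.mem_sigma.1 ha).1)⟩) ?_ ?_ ?_ ?_
  · intro a _ _; exact Finset.mem_univ _
  · rintro ⟨n, φ⟩ h1 - ⟨n', ψ⟩ h1' - h
    have hc : content φ = content ψ := funext fun f => congrArg Fin.val (congrFun h f)
    obtain rfl : n = n' := by rw [← sum_content φ, hc, sum_content]
    exact congrArg (Sigma.mk n) (eq_of_monotone_of_content_eq
      (Finset.mem_filter.1 (Finset.mem_sigma.1 h1).2).2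
      (Finset.mem_filter.1 (Finset.mem_sigma.1 h1').2).2 hc)
  · intro m _ hm
    -- Multiplicities below `K` may still add up to `K` or more; such terms contain `z ^ K` and
    -- vanish.
    have hlt : ∑ f, (m f : ℕ) < K := by
      by_contra hge
      obtain ⟨d, hd⟩ := Nat.exists_eq_add_of_le (not_lt.1 hge)
      apply hm
      simp only [mul_pow]
      rw [Finset.prod_mul_distrib, Finset.prod_pow_eq_pow_sum, hd, pow_add, hz, zero_mul, zero_mul,
        zero_mul]
    obtain ⟨φ, hφ, hcm⟩ := exists_monotone_content_eq (fun f => (m f : ℕ)) rfl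
    have hmem : (⟨_, φ⟩ : Σ n, (Fin n → Fin N)) ∈ (Finset.range K).sigma
        (fun n => Finset.univ.filter fun φ : Fin n → Fin N => Monotone φ) :=
      Finset.mem_sigma.2 ⟨Finset.mem_range.2 hlt, Finset.mem_filter.2 ⟨Finset.mem_univ _, hφ⟩⟩
    refine ⟨⟨_, φ⟩, hmem, ?_, ?_⟩
    · intro h0
      apply hm
      refine Eq.trans ?_ h0
      rw [← prod_pow_content φ (fun f => c f), hcm]
      simp only [mul_pow]
      rw [Finset.prod_mul_distrib, Finset.prod_pow_eq_pow_sum, mul_assoc]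
    · funext f
      exact Fin.ext (congrFun hcm f)
  · rintro ⟨n, φ⟩ _ _
    simp only [mul_pow]
    rw [Finset.prod_mul_distrib, Finset.prod_pow_eq_pow_sum, sum_content,
      prod_pow_content φ (fun f => c f), mul_assoc]

/-! ### Encoding a permutation and a sequence as a word -/

/-- The drops forced by the lexicographic descents. -/
noncomputable def dexDrop {n : ℕ} (σ : Equiv.Perm (Fin n)) (i : Fin n) : ℕ :=
  if i ∈ dexSet σ then 1 else 0

/-- The letter of the triple indexed by `M - 1 - f i` whose type is that of position `i`. -/
def kindWord {n M : ℕ} (σ : Equiv.Perm (Fin n)) (f : Fin n → Fin M) (i : Fin n) : Fin (3 * M) :=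
  ⟨3 * (M - 1 - f i) + kind σ i, by have := (f i).isLt; have := (kind σ i).isLt; omega⟩

theorem forall_lt_of_forall_succ {n : ℕ} {P : Fin n → Fin n → Prop}
    (htrans : ∀ i j k, P i j → P j k → P i k) (h : ∀ i j : Fin n, (j : ℕ) = i + 1 → P i j)
    {i j : Fin n} (hij : i < j) : P i j := by
  obtain ⟨d, hd⟩ := Nat.exists_eq_add_of_lt (Fin.lt_def.1 hij)
  induction d generalizing j with
  | zero => exact h i j hd
  | succ d ih =>
    have hk : (i : ℕ) + d + 1 < n := by have := j.isLt; omega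
    exact htrans i ⟨i + d + 1, hk⟩ j (ih (Fin.lt_def.2 (by simp only; omega)) rfl) (h _ _ hd)

theorem mem_dexSet_iff {n : ℕ} {σ : Equiv.Perm (Fin n)} {i j : Fin n} (hij : (j : ℕ) = i + 1) :
    i ∈ dexSet σ ↔ ¬ (kind σ i < kind σ j ∨ (kind σ i = kind σ j ∧ σ i < σ j)) := by
  simp only [dexSet, Finset.mem_filter, Finset.mem_univ, true_and]
  constructor
  · rintro ⟨k, hk, h⟩
    obtain rfl : k = j := Fin.ext (hk.trans hij.symm)
    exact h
  · intro h; exact ⟨j, hij, h⟩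

theorem tripleKind_kindWord {n M : ℕ} (σ : Equiv.Perm (Fin n)) (f : Fin n → Fin M) (i : Fin n) :
    tripleKind (kindWord σ f i) = kind σ i := by
  refine Fin.ext ?_
  have := (kind σ i).isLt
  simp only [tripleKind, kindWord]
  omega

/-- Both sides say that the triple (reversed `f`, type, value of `σ`) increases lexicographically;
transitivity reduces this to consecutive positions. -/
theorem admissible_kindWord_iff {n M : ℕ} (σ : Equiv.Perm (Fin n)) (f : Fin n → Fin M) :
    Admissible tripleKind σ (kindWord σ f) ↔ DropsBy (dexDrop σ) (fun i => (f i : ℕ)) := by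
  have hcons : ∀ i j : Fin n, (j : ℕ) = i + 1 → ((f j : ℕ) + dexDrop σ i ≤ f i ↔
      (kindWord σ f i < kindWord σ f j ∨ (kindWord σ f i = kindWord σ f j ∧ σ i < σ j))) := by
    intro i j hij
    have h1 := (f i).isLt
    have h2 := (f j).isLt
    have h3 := (kind σ i).isLt
    have h4 := (kind σ j).isLt
    simp only [dexDrop, mem_dexSet_iff hij, kindWord, Fin.lt_def, Fin.ext_iff]
    split_ifs with h <;> omega
  constructor
  · rintro ⟨hm, hinc, -⟩ i j hij
    have hlt : i < j := Fin.lt_def.2 (by omega)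
    rw [hcons i j hij]
    rcases (hm hlt.le).lt_or_eq with h | h
    · exact Or.inl h
    · exact Or.inr ⟨h, hinc i j hlt h⟩
  · intro h
    have hall : ∀ {i j : Fin n}, i < j →
        (kindWord σ f i < kindWord σ f j ∨ (kindWord σ f i = kindWord σ f j ∧ σ i < σ j)) := by
      intro i j hij
      refine forall_lt_of_forall_succ (P := fun i j => kindWord σ f i < kindWord σ f j ∨
        (kindWord σ f i = kindWord σ f j ∧ σ i < σ j)) ?_ (fun i j hij => (hcons i j hij).1
          (h i j hij)) hij
      simp only [Fin.lt_def, Fin.ext_iff]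
      omega
    refine ⟨fun i j hij => ?_, fun i j hij he => ?_, tripleKind_kindWord σ f⟩
    · rcases hij.lt_or_eq with hlt | rfl
      · exact (hall hlt).elim le_of_lt fun h => h.1.le
      · exact le_rfl
    · exact (hall hij).elim (fun h => absurd he h.ne) fun h => h.2

theorem exists_kindWord_eq {n M : ℕ} {σ : Equiv.Perm (Fin n)} {φ : Fin n → Fin (3 * M)}
    (h : ∀ i, tripleKind (φ i) = kind σ i) : ∃ f : Fin n → Fin M, kindWord σ f = φ := by
  refine ⟨fun i => ⟨M - 1 - (φ i : ℕ) / 3, by have := (φ i).isLt; omega⟩, ?_⟩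
  funext i
  refine Fin.ext ?_
  have h1 := (φ i).isLt
  have h2 : (φ i : ℕ) % 3 = kind σ i := congrArg Fin.val (h i)
  simp only [kindWord]
  omega

theorem kindWord_injective {n M : ℕ} (σ : Equiv.Perm (Fin n)) :
    Function.Injective (kindWord (M := M) σ) := by
  intro f g h
  funext i
  refine Fin.ext ?_
  have h1 := congrArg Fin.val (congrFun h i)
  have := (f i).isLt
  have := (g i).isLt
  simp only [kindWord] at h1
  omega

/-- The weights of the letters, without the variable `z`. -/
def letterWeight {R : Type*} [CommRing R] (M : ℕ) (q T r : R) (i : ℕ) : R :=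
  (if tripleKind i = 0 then T else if tripleKind i = 1 then 1 else r) * q ^ (M - 1 - i / 3)

theorem prod_kind {R : Type*} [CommRing R] {n : ℕ} (σ : Equiv.Perm (Fin n)) (T r : R) :
    ∏ i, (if kind σ i = 0 then T else if kind σ i = 1 then 1 else r) = T ^ exc σ * r ^ fix σ := by
  rw [exc, fix, ← Finset.prod_const, ← Finset.prod_const, Finset.prod_filter, Finset.prod_filter,
    ← Finset.prod_mul_distrib]
  refine Finset.prod_congr rfl fun i _ => ?_
  simp only [kind_eq_zero, kind_eq_one]
  rcases lt_trichotomy i (σ i) with h | h | h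
  · simp [h, h.ne']
  · simp [← h]
  · simp [h, h.not_gt, h.ne]

theorem prod_letterWeight_kindWord {R : Type*} [CommRing R] {n M : ℕ} (q T r : R)
    (σ : Equiv.Perm (Fin n)) (f : Fin n → Fin M) :
    ∏ i, letterWeight M q T r (kindWord σ f i)
      = T ^ exc σ * r ^ fix σ * q ^ ∑ i, (f i : ℕ) := by
  simp only [letterWeight, tripleKind_kindWord]
  rw [Finset.prod_mul_distrib, prod_kind, ← Finset.prod_pow_eq_pow_sum]
  congr 1
  refine Finset.prod_congr rfl fun i _ => ?_
  congr 1
  have := (f i).isLt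
  have := (kind σ i).isLt
  simp only [kindWord]
  omega

open Classical in
theorem sum_admissible {R : Type*} [CommRing R] {n : ℕ} (M : ℕ) (q t r : R) (hq : q ^ M = 0)
    (σ : Equiv.Perm (Fin n)) :
    (∏ i ∈ Finset.range n, (1 - q ^ (i + 1))) * ∑ φ : Fin n → Fin (3 * M),
      (if Admissible tripleKind σ φ then ∏ i, letterWeight M q (t * q) r (φ i) else 0)
      = q ^ maj σ * t ^ exc σ * r ^ fix σ := by
  have h1 : ∑ φ : Fin n → Fin (3 * M),
      (if Admissible tripleKind σ φ then ∏ i, letterWeight M q (t * q) r (φ i) else 0)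
      = (t * q) ^ exc σ * r ^ fix σ * ∑ f : Fin n → Fin M,
        (if DropsBy (dexDrop σ) (fun i => (f i : ℕ)) then q ^ ∑ i, (f i : ℕ) else 0) := by
    rw [← Finset.sum_filter, ← Finset.sum_filter, Finset.mul_sum]
    symm
    refine Finset.sum_bij (fun f _ => kindWord σ f) ?_ ?_ ?_ ?_
    · intro f hf
      exact Finset.mem_filter.2 ⟨Finset.mem_univ _,
        (admissible_kindWord_iff σ f).2 (Finset.mem_filter.1 hf).2⟩
    · intro f _ g _ h
      exact kindWord_injective σ h
    · intro φ hφ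
      have hA := (Finset.mem_filter.1 hφ).2
      obtain ⟨f, rfl⟩ := exists_kindWord_eq hA.2.2
      exact ⟨f, Finset.mem_filter.2 ⟨Finset.mem_univ _, (admissible_kindWord_iff σ f).1 hA⟩, rfl⟩
    · intro f _
      rw [prod_letterWeight_kindWord]
  have h2 := sum_dropsBy q M hq n 0 (dexDrop σ) (fun i hi => if_neg fun h => by
    simp only [dexSet, Finset.mem_filter, Finset.mem_univ, true_and] at h
    obtain ⟨j, hj, -⟩ := h
    have := j.isLt
    omega)
  have h3 : ∑ i : Fin n, (0 + (i : ℕ) + 1) * dexDrop σ i = ∑ i ∈ dexSet σ, ((i : ℕ) + 1) := by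
    simp only [dexDrop, mul_ite, mul_one, mul_zero, zero_add]
    rw [← Finset.sum_filter, Finset.filter_mem_eq_inter, Finset.univ_inter]
  simp only [zero_mul, ite_self, Finset.sum_const_zero, add_zero] at h2
  rw [h3, Fin.prod_univ_eq_prod_range (fun i => 1 - q ^ (0 + i + 1)) n] at h2
  simp only [zero_add] at h2
  rw [h1, mul_left_comm, h2, maj_eq_sum_dexSet_add_exc, pow_add, mul_pow]
  ring

open Classical in
theorem sum_sum_admissible {R : Type*} [CommRing R] (n M : ℕ) (q t r : R) (hq : q ^ M = 0) :
    (∏ i ∈ Finset.range n, (1 - q ^ (i + 1))) * ∑ σ : Equiv.Perm (Fin n),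
      ∑ φ : Fin n → Fin (3 * M),
        (if Admissible tripleKind σ φ then ∏ i, letterWeight M q (t * q) r (φ i) else 0)
      = eulerPoly n q t r := by
  rw [Finset.mul_sum, eulerPoly]
  exact Finset.sum_congr rfl fun σ _ => sum_admissible M q t r hq σ

/-! ### Euler's product and the truncated identity -/

/-- A truncation of the `q`-exponential series. -/
def truncExp {R : Type*} [CommRing R] (K : ℕ) (e : ℕ → R) (v : R) : R :=
  ∑ n ∈ Finset.range K, e n * v ^ n

theorem truncExp_mul {R : Type*} [CommRing R] {K : ℕ} {e : ℕ → R} {q : R}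
    (he : ∀ n, e (n + 1) * (1 - q ^ (n + 1)) = e n) {v : R} (hv : v ^ K = 0) :
    truncExp K e (q * v) = (1 - v) * truncExp K e v := by
  have h1 : ∑ n ∈ Finset.range K, e n * v ^ (n + 1)
      = ∑ n ∈ Finset.range K, e n * (1 - q ^ n) * v ^ n := by
    have e1 := Finset.sum_range_succ (fun n => e n * (1 - q ^ n) * v ^ n) K
    have e2 := Finset.sum_range_succ' (fun n => e n * (1 - q ^ n) * v ^ n) K
    rw [hv, mul_zero, add_zero] at e1
    rw [← e1, e2]
    simp [he]
  have h2 : truncExp K e v * v = ∑ n ∈ Finset.range K, e n * v ^ (n + 1) := by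
    rw [truncExp, Finset.sum_mul]
    exact Finset.sum_congr rfl fun n _ => by ring
  rw [sub_mul, one_mul, mul_comm v, h2, h1, truncExp, truncExp, ← Finset.sum_sub_distrib]
  exact Finset.sum_congr rfl fun n _ => by ring

/-- Iterate `E(q v) = (1 - v) E(v)` for `M` steps; then `q ^ M v = 0` and `E(0) = 1`. -/
theorem prod_mul_truncExp {R : Type*} [CommRing R] {K M : ℕ} {e : ℕ → R} {q : R} (h0 : e 0 = 1)
    (he : ∀ n, e (n + 1) * (1 - q ^ (n + 1)) = e n) (hq : q ^ M = 0) {v : R} (hv : v ^ K = 0) :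
    (∏ i ∈ Finset.range M, (1 - q ^ i * v)) * truncExp K e v = 1 := by
  have h : ∀ j, truncExp K e (q ^ j * v)
      = (∏ i ∈ Finset.range j, (1 - q ^ i * v)) * truncExp K e v := by
    intro j
    induction j with
    | zero => simp
    | succ j ih =>
      rw [pow_succ', mul_assoc, truncExp_mul he (by rw [mul_pow, hv, mul_zero]), ih,
        Finset.prod_range_succ]
      ring
  rw [← h, hq, zero_mul, truncExp]
  cases K with
  | zero =>
    have : Subsingleton R := subsingleton_of_zero_eq_one (by simpa using hv.symm)
    exact Subsingleton.elim _ _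
  | succ K => simp [Finset.sum_range_succ', h0]

theorem truncated_identity {R : Type*} [CommRing R] {K M : ℕ} {e : ℕ → R} {q : R} (t r z : R)
    (he : ∀ n, e n * ∏ i ∈ Finset.range n, (1 - q ^ (i + 1)) = 1) (hq : q ^ M = 0)
    (hz : z ^ K = 0) :
    (∑ n ∈ Finset.range K, e n * eulerPoly n q t r * z ^ n) *
        (truncExp K e (t * q * z) - t * q * truncExp K e z)
      = (1 - t * q) * truncExp K e (r * z) := by
  classical
  have h0 : e 0 = 1 := by simpa using he 0
  have he' : ∀ n, e (n + 1) * (1 - q ^ (n + 1)) = e n := fun n => by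
    have h1 := he (n + 1)
    rw [Finset.prod_range_succ] at h1
    linear_combination e n * h1 - e (n + 1) * (1 - q ^ (n + 1)) * he n
  set x : ℕ → R := fun j => z * q ^ (M - 1 - j) with hx
  have hxK : ∀ i, x i ^ K = 0 := fun i => by rw [hx]; simp only [mul_pow, hz, zero_mul]
  have hprod : ∀ a : R, (∏ i ∈ Finset.range M, (1 - a * x i)) * truncExp K e (a * z) = 1 := by
    intro a
    refine Eq.trans ?_ (prod_mul_truncExp h0 he' hq (v := a * z) (by rw [mul_pow, hz, mul_zero]))
    -- The larger letters carry the smaller powers of `q`, so the product over `x` is the Euler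
    -- product read backwards.
    rw [← Finset.prod_range_reflect (fun i => 1 - q ^ i * (a * z)) M]
    congr 1
    exact Finset.prod_congr rfl fun i _ => by simp only [hx]; ring
  -- The value `w = 1` is the undeformed case `u = 0`, where the bracket becomes `P - t q Q`.
  have hword := wordSum_triple K (t * q) r M x hxK 1
  have hw : tripleWeight (t * q) r x = fun i => z * letterWeight M q (t * q) r i := by
    funext i
    simp only [tripleWeight, letterWeight, hx]
    ring
  have hZ : wordSum K (3 * M) tripleKind (tripleWeight (t * q) r x) (1 - 1)
      = ∑ n ∈ Finset.range K, e n * eulerPoly n q t r * z ^ n := by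
    rw [hw, sub_self, wordSum_eq_sum_perm K (3 * M) tripleKind z hz]
    refine Finset.sum_congr rfl fun n _ => ?_
    rw [← sum_sum_admissible n M q t r hq]
    linear_combination (-(z ^ n * ∑ σ : Equiv.Perm (Fin n), ∑ φ : Fin n → Fin (3 * M),
        (if Admissible tripleKind σ φ then ∏ i, letterWeight M q (t * q) r (φ i) else 0))) * he n
  rw [hZ] at hword
  have hr := hprod r
  have hT := hprod (t * q)
  have h1 := hprod 1
  simp only [one_mul] at h1 hword
  set Z := ∑ n ∈ Finset.range K, e n * eulerPoly n q t r * z ^ n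
  set Er := truncExp K e (r * z)
  set ET := truncExp K e (t * q * z)
  set E1 := truncExp K e z
  set Fr := ∏ i ∈ Finset.range M, (1 - r * x i)
  set Q := ∏ i ∈ Finset.range M, (1 - t * q * x i)
  set P := ∏ i ∈ Finset.range M, (1 - x i)
  calc Z * (ET - t * q * E1)
      = Z * (Fr * Er) * ((P * E1) * ET - t * q * (Q * ET) * E1) := by rw [hr, h1, hT]; ring
    _ = (Z * Fr * (P + (1 - t * q - 1) * Q)) * (Er * E1 * ET) := by ring
    _ = (1 - t * q) * (Q * ET) * (P * E1) * Er := by rw [hword]; ring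
    _ = (1 - t * q) * Er := by rw [hT, h1]; ring

/-! ### From nilpotent variables to rational functions -/

open Finset.HasAntidiagonal (antidiagonal)

theorem map_eulerPoly {R S : Type*} [CommSemiring R] [CommSemiring S] (φ : R →+* S) (n : ℕ)
    (q t r : R) : φ (eulerPoly n q t r) = eulerPoly n (φ q) (φ t) (φ r) := by
  simp [eulerPoly]

theorem antidiagonal_le {n : ℕ} {p : ℕ × ℕ} (hp : p ∈ antidiagonal n) : p.1 ≤ n ∧ p.2 ≤ n := by
  have := Finset.HasAntidiagonal.mem_antidiagonal.1 hp
  omega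

theorem coeff_sum_range_C_mul_X_pow {R : Type*} [CommRing R] (K n : ℕ) (hn : n < K) (a : ℕ → R) :
    PowerSeries.coeff n (∑ m ∈ Finset.range K, PowerSeries.C (a m) * PowerSeries.X ^ m) = a n := by
  rw [map_sum]
  simp only [PowerSeries.coeff_C_mul_X_pow]
  rw [Finset.sum_ite_eq, if_pos (Finset.mem_range.2 hn)]

/-- Take for `z` the class of `X` modulo `X ^ (n + 1)` and compare coefficients of `X ^ n`. -/
theorem nilpotent_identity {R : Type*} [CommRing R] {M : ℕ} {e : ℕ → R} {q : R} (t r : R)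
    (he : ∀ n, e n * ∏ i ∈ Finset.range n, (1 - q ^ (i + 1)) = 1) (hq : q ^ M = 0) (n : ℕ) :
    ∑ p ∈ antidiagonal n, e p.1 * eulerPoly p.1 q t r *
        (e p.2 * ((t * q) ^ p.2 - t * q)) = (1 - t * q) * (e n * r ^ n) := by
  let I : Ideal (PowerSeries R) := Ideal.span {PowerSeries.X ^ (n + 1)}
  let π : PowerSeries R →+* PowerSeries R ⧸ I := Ideal.Quotient.mk I
  let ψ : R →+* PowerSeries R ⧸ I := π.comp PowerSeries.C
  have hz : π PowerSeries.X ^ (n + 1) = 0 := by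
    rw [← map_pow]
    exact Ideal.Quotient.eq_zero_iff_mem.2 (Ideal.mem_span_singleton_self _)
  have key := truncated_identity (K := n + 1) (M := M) (e := fun n => ψ (e n)) (q := ψ q)
    (ψ t) (ψ r) (π PowerSeries.X)
    (fun k => by
      have hk := congrArg ψ (he k)
      rw [map_mul, map_prod, map_one] at hk
      simpa using hk) (by rw [← map_pow, hq, map_zero]) hz
  have htr : ∀ a : R, truncExp (n + 1) (fun n => ψ (e n)) (ψ a * π PowerSeries.X)
      = π (∑ m ∈ Finset.range (n + 1), PowerSeries.C (e m * a ^ m) * PowerSeries.X ^ m) := by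
    intro a
    rw [truncExp, map_sum]
    exact Finset.sum_congr rfl fun m _ => by simp [ψ]; ring
  have htr1 := htr 1
  have hA : ∑ m ∈ Finset.range (n + 1), ψ (e m) * eulerPoly m (ψ q) (ψ t) (ψ r) *
        π PowerSeries.X ^ m = π (∑ m ∈ Finset.range (n + 1),
          PowerSeries.C (e m * eulerPoly m q t r) * PowerSeries.X ^ m) := by
    rw [map_sum]
    refine Finset.sum_congr rfl fun m _ => ?_
    rw [← map_eulerPoly ψ]
    simp [ψ]
  simp only [map_one, one_mul, one_pow, mul_one] at htr1
  rw [hA, ← map_mul ψ, htr, htr, htr1, ← map_one ψ, ← map_sub ψ] at key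
  have key' : π ((∑ m ∈ Finset.range (n + 1),
          PowerSeries.C (e m * eulerPoly m q t r) * PowerSeries.X ^ m) *
      ((∑ m ∈ Finset.range (n + 1), PowerSeries.C (e m * (t * q) ^ m) * PowerSeries.X ^ m)
        - PowerSeries.C (t * q) *
          ∑ m ∈ Finset.range (n + 1), PowerSeries.C (e m) * PowerSeries.X ^ m))
      = π (PowerSeries.C (1 - t * q) *
        ∑ m ∈ Finset.range (n + 1), PowerSeries.C (e m * r ^ m) * PowerSeries.X ^ m) := by
    rw [map_mul, map_sub, map_mul π (PowerSeries.C _), map_mul π (PowerSeries.C _)]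
    exact key
  rw [Ideal.Quotient.eq, Ideal.mem_span_singleton, PowerSeries.X_pow_dvd_iff] at key'
  have hc := key' n (Nat.lt_succ_self n)
  rw [map_sub, sub_eq_zero, PowerSeries.coeff_mul, PowerSeries.coeff_C_mul,
    coeff_sum_range_C_mul_X_pow _ _ (Nat.lt_succ_self n)] at hc
  rw [← hc]
  refine Finset.sum_congr rfl fun p hp => ?_
  have h1 : p.1 < n + 1 := Nat.lt_succ_of_le (antidiagonal_le hp).1
  have h2 : p.2 < n + 1 := Nat.lt_succ_of_le (antidiagonal_le hp).2
  rw [map_sub, PowerSeries.coeff_C_mul, coeff_sum_range_C_mul_X_pow _ _ h1,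
    coeff_sum_range_C_mul_X_pow _ _ h2, coeff_sum_range_C_mul_X_pow _ _ h2]
  ring

/-- The product of the `1 - q ^ (i + 1)` over `k ≤ i < n`. -/
def pochRatio {R : Type*} [CommRing R] (q : R) (k n : ℕ) : R :=
  ∏ i ∈ Finset.Ico k n, (1 - q ^ (i + 1))

theorem prod_range_mul_pochRatio {R : Type*} [CommRing R] (q : R) {k n : ℕ} (h : k ≤ n) :
    (∏ i ∈ Finset.range k, (1 - q ^ (i + 1))) * pochRatio q k n
      = ∏ i ∈ Finset.range n, (1 - q ^ (i + 1)) :=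
  Finset.prod_range_mul_prod_Ico _ h

theorem map_pochRatio {R S : Type*} [CommRing R] [CommRing S] (φ : R →+* S) (q : R) (k n : ℕ) :
    φ (pochRatio q k n) = pochRatio (φ q) k n := by
  simp [pochRatio]

/-- This is `nilpotent_identity` multiplied by the square of `(q)_n`, so that it makes sense without
inverses. -/
theorem nilpotent_recurrence {R : Type*} [CommRing R] {M : ℕ} {q : R} (t r : R) (hq : q ^ M = 0)
    (n : ℕ) :
    ∑ p ∈ antidiagonal n, pochRatio q p.1 n * eulerPoly p.1 q t r *
        (pochRatio q p.2 n * ((t * q) ^ p.2 - t * q))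
      = (1 - t * q) * (pochRatio q 0 n * r ^ n) := by
  have hunit : ∀ n, IsUnit (∏ i ∈ Finset.range n, (1 - q ^ (i + 1))) := by
    intro n
    refine Finset.prod_induction _ IsUnit (fun _ _ => IsUnit.mul) isUnit_one fun i _ => ?_
    exact IsNilpotent.isUnit_one_sub ⟨M, by rw [← pow_mul, mul_comm, pow_mul, hq, zero_pow (by omega)]⟩
  choose e he using fun n => (hunit n).exists_left_inv
  have h := nilpotent_identity t r he hq n
  set G := ∏ i ∈ Finset.range n, (1 - q ^ (i + 1)) with hG
  have hpoch : ∀ k ≤ n, pochRatio q k n = e k * G := fun k hk => by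
    rw [hG, ← prod_range_mul_pochRatio q hk, ← mul_assoc, he, one_mul]
  have h0 : pochRatio q 0 n = e n * G * G := by
    rw [he n, one_mul, hG, pochRatio, Finset.range_eq_Ico]
  rw [h0]
  have : ∀ p ∈ antidiagonal n, pochRatio q p.1 n * eulerPoly p.1 q t r *
        (pochRatio q p.2 n * ((t * q) ^ p.2 - t * q))
      = e p.1 * eulerPoly p.1 q t r * (e p.2 * ((t * q) ^ p.2 - t * q)) * (G * G) := fun p hp => by
    rw [hpoch _ (antidiagonal_le hp).1, hpoch _ (antidiagonal_le hp).2]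
    ring
  rw [Finset.sum_congr rfl this, ← Finset.sum_mul, h]
  ring

theorem polynomial_recurrence (n : ℕ) (q t r : MvPolynomial (Fin 3) ℚ)
    (hq : q = MvPolynomial.X 0) :
    ∑ p ∈ antidiagonal n, pochRatio q p.1 n * eulerPoly p.1 q t r *
        (pochRatio q p.2 n * ((t * q) ^ p.2 - t * q))
      = (1 - t * q) * (pochRatio q 0 n * r ^ n) := by
  rw [← sub_eq_zero]
  by_contra hne
  have hnu : ¬ IsUnit q := by
    rw [hq]
    intro h
    have := h.map (MvPolynomial.eval (fun _ : Fin 3 => (0 : ℚ)))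
    simp at this
  -- A nonzero polynomial is not divisible by all powers of the nonunit `q`, whereas the recurrence
  -- modulo `q ^ (M + 1)` makes the difference divisible by that power.
  obtain ⟨M, hM⟩ := FiniteMultiplicity.of_not_isUnit hnu hne
  apply hM
  let π := Ideal.Quotient.mk (Ideal.span {q ^ (M + 1)})
  have hπ : π q ^ (M + 1) = 0 := by
    rw [← map_pow]
    exact Ideal.Quotient.eq_zero_iff_mem.2 (Ideal.mem_span_singleton_self _)
  have h := nilpotent_recurrence (π t) (π r) hπ n
  rw [← Ideal.mem_span_singleton, ← Ideal.Quotient.eq]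
  change π _ = π _
  rw [map_sum, map_mul π (1 - t * q), map_mul π (pochRatio q 0 n), map_pochRatio, map_sub, map_one,
    map_mul, map_pow, ← h]
  refine Finset.sum_congr rfl fun p _ => ?_
  simp only [map_mul, map_sub, map_pow, map_pochRatio, map_eulerPoly]

theorem pow_mul_qFact {R : Type*} [CommRing R] (q : R) (n : ℕ) :
    (1 - q) ^ n * qFact q n = ∏ i ∈ Finset.range n, (1 - q ^ (i + 1)) := by
  induction n with
  | zero => simp [qFact]
  | succ n ih =>
    have hI : (1 - q) * qInt q (n + 1) = 1 - q ^ (n + 1) := mul_neg_geom_sum q (n + 1)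
    have hF : qFact q (n + 1) = qFact q n * qInt q (n + 1) :=
      Finset.prod_Icc_succ_top (by omega) _
    rw [Finset.prod_range_succ, ← ih, hF, ← hI]
    ring

theorem field_recurrence (n : ℕ) :
    ∑ p ∈ antidiagonal n, eulerPoly p.1 qVar tVar rVar / qFact qVar p.1 *
        ((qFact qVar p.2)⁻¹ * (tVar * qVar) ^ p.2 - tVar * qVar * (qFact qVar p.2)⁻¹)
      = (1 - tVar * qVar) * ((qFact qVar n)⁻¹ * rVar ^ n) := by
  have h := congrArg (algebraMap (MvPolynomial (Fin 3) ℚ) RatFun3)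
    (polynomial_recurrence n _ (MvPolynomial.X 1) (MvPolynomial.X 2) rfl)
  have hq1 : (1 - qVar : RatFun3) ≠ 0 := by
    intro h1
    have h2 : algebraMap (MvPolynomial (Fin 3) ℚ) RatFun3 (1 - MvPolynomial.X 0) = 0 := by
      rw [map_sub, map_one]; exact h1
    have h3 := congrArg (MvPolynomial.eval (fun _ => (0 : ℚ)))
      (IsFractionRing.injective (MvPolynomial (Fin 3) ℚ) RatFun3 (h2.trans (map_zero _).symm))
    simp at h3
  simp only [map_sum, map_mul, map_sub, map_pow, map_one, map_pochRatio, map_eulerPoly] at h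
  change ∑ p ∈ antidiagonal n, pochRatio qVar p.1 n * eulerPoly p.1 qVar tVar rVar *
        (pochRatio qVar p.2 n * ((tVar * qVar) ^ p.2 - tVar * qVar))
      = (1 - tVar * qVar) * (pochRatio qVar 0 n * rVar ^ n) at h
  set q := qVar
  set t := tVar
  set r := rVar
  have hF : ∀ k, qFact q k ≠ 0 := qFact_qVar_ne_zero
  set G := (1 - q) ^ n * qFact q n with hG
  have hG0 : G ≠ 0 := mul_ne_zero (pow_ne_zero _ hq1) (hF n)
  have hpoch : ∀ k ≤ n, pochRatio q k n = G * ((1 - q) ^ k * qFact q k)⁻¹ := fun k hk => by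
    rw [eq_mul_inv_iff_mul_eq₀ (mul_ne_zero (pow_ne_zero _ hq1) (hF k)), hG, pow_mul_qFact,
      pow_mul_qFact, mul_comm, prod_range_mul_pochRatio q hk]
  have h0 : pochRatio q 0 n = G := by
    rw [hpoch 0 (Nat.zero_le n)]; simp [qFact]
  -- Since `p.1 + p.2 = n`, the powers of `1 - q` separating `(q)_k` from `[k]_q!` combine to a
  -- factor independent of `p`.
  have hterm : ∀ p ∈ antidiagonal n, pochRatio q p.1 n * eulerPoly p.1 q t r *
        (pochRatio q p.2 n * ((t * q) ^ p.2 - t * q))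
      = G * G * ((1 - q) ^ n)⁻¹ * (eulerPoly p.1 q t r / qFact q p.1 *
        ((qFact q p.2)⁻¹ * (t * q) ^ p.2 - t * q * (qFact q p.2)⁻¹)) := fun p hp => by
    rw [hpoch _ (antidiagonal_le hp).1, hpoch _ (antidiagonal_le hp).2,
      ← Finset.HasAntidiagonal.mem_antidiagonal.1 hp, pow_add, mul_inv, mul_inv, mul_inv]
    ring
  rw [Finset.sum_congr rfl hterm, ← Finset.mul_sum, h0] at h
  have hc : G * G * ((1 - q) ^ n)⁻¹ ≠ 0 :=
    mul_ne_zero (mul_ne_zero hG0 hG0) (inv_ne_zero (pow_ne_zero _ hq1))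
  apply mul_left_cancel₀ hc
  rw [h]
  have : G * ((1 - q) ^ n)⁻¹ * (qFact q n)⁻¹ = 1 := by
    rw [mul_assoc, ← mul_inv, mul_inv_cancel₀ hG0]
  linear_combination (-((1 - t * q) * G * r ^ n)) * this

end QEuler

theorem corollary1p3 :
    (PowerSeries.mk fun n => QEuler.eulerPoly n QEuler.qVar QEuler.tVar QEuler.rVar
        / QEuler.qFact QEuler.qVar n : PowerSeries QEuler.RatFun3)
      = PowerSeries.C (1 - QEuler.tVar * QEuler.qVar)
        * PowerSeries.rescale QEuler.rVar (QEuler.qExp QEuler.qVar)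
        * (PowerSeries.rescale (QEuler.tVar * QEuler.qVar) (QEuler.qExp QEuler.qVar)
            - PowerSeries.C (QEuler.tVar * QEuler.qVar) * QEuler.qExp QEuler.qVar)⁻¹ := by
  rw [PowerSeries.eq_mul_inv_iff_mul_eq QEuler.constantCoeff_denominator_ne_zero]
  ext n
  rw [PowerSeries.coeff_mul, PowerSeries.coeff_C_mul, PowerSeries.coeff_rescale]
  simp only [map_sub, PowerSeries.coeff_C_mul, PowerSeries.coeff_rescale, QEuler.qExp,
    PowerSeries.coeff_mk]
  rw [mul_comm (QEuler.rVar ^ n), ← QEuler.field_recurrence n]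
  refine Finset.sum_congr rfl fun p _ => ?_
  ring
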